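/- Let $d\ge 2$ be an integer and $\delta\in(0,1]$. There is a constant $\nu=\nu(d,\delta)>0$ such that for every $K\ge 0$ there is $R_0=R_0(d,\delta,K)>2$ with the following property. Write $B_R=\{x\in\mathbb{R}^d: |x|<R\}$. Let $a=[a^{ij}]$ be a measurable symmetric $d\times d$ matrix-valued function on $\mathbb{R}^d$ with $\delta|\xi|^2\le \sum_{i,j}a^{ij}(x)\xi_i\xi_j\le\delta^{-1}|\xi|^2$ for all $x,\xi\in\mathbb{R}^d$, and let $b=(b^1,\dots,b^d)$ be a measurable $\mathbb{R}^d$-valued function on $B_{R_0}$ with $\bigl(\int_{B_{R_0}}|b|^d\,dx\bigr)^{1/d}\le K$. Suppose that $u\in W^2_d(B_{R_0})$ (that is, $u$ and its weak derivatives $D_iu$, $D_{ij}u$ belong to $L_d(B_{R_0})$), where $u$ is taken as its continuous representative, $u\in C(\overline{B_{R_0}})$, that $$\sum_{i,j}a^{ij}D_{ij}u+\sum_i b^iD_iu=-1\quad\text{almost everywhere in }B_{R_0},$$ and that $u\ge 0$ on $\partial B_{R_0}$. Then $u(x)\ge\nu$ for every $x\in B_1$. -/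

import Mathlib

open MeasureTheory Metric
open scoped ContDiff ENNReal

/-- `φ ∈ C_c^∞(Ω)`. -/
def IsTestFunction {d : ℕ} (Ω : Set (EuclideanSpace ℝ (Fin d)))
    (φ : EuclideanSpace ℝ (Fin d) → ℝ) : Prop :=
  ContDiff ℝ ∞ φ ∧ HasCompactSupport φ ∧ tsupport φ ⊆ Ω

/-- `g` is the weak partial derivative `D_i u` of `u` in `Ω`: both functions are locally integrable
in `Ω`, and `∫_Ω u D_i φ = - ∫_Ω g φ` for every `φ ∈ C_c^∞(Ω)`. -/
structure HasWeakPartialDeriv {d : ℕ} (Ω : Set (EuclideanSpace ℝ (Fin d))) (i : Fin d)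
    (u g : EuclideanSpace ℝ (Fin d) → ℝ) : Prop where
  locallyIntegrableOn : LocallyIntegrableOn u Ω volume
  locallyIntegrableOn_deriv : LocallyIntegrableOn g Ω volume
  integral_eq : ∀ φ : EuclideanSpace ℝ (Fin d) → ℝ, IsTestFunction Ω φ →
    ∫ x in Ω, u x * fderiv ℝ φ x (EuclideanSpace.single i 1) = - ∫ x in Ω, g x * φ x

/-- `u ∈ W^2_p(Ω)`, with first weak derivatives `Du i = D_i u` and second weak derivatives
`D2u i j = D_i D_j u`. The weak derivatives are determined by `u` up to null sets. -/
structure MemW2 {d : ℕ} (Ω : Set (EuclideanSpace ℝ (Fin d))) (p : ℝ≥0∞)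
    (u : EuclideanSpace ℝ (Fin d) → ℝ)
    (Du : Fin d → EuclideanSpace ℝ (Fin d) → ℝ)
    (D2u : Fin d → Fin d → EuclideanSpace ℝ (Fin d) → ℝ) : Prop where
  memLp : MemLp u p (volume.restrict Ω)
  memLp_first : ∀ i, MemLp (Du i) p (volume.restrict Ω)
  memLp_second : ∀ i j, MemLp (D2u i j) p (volume.restrict Ω)
  first : ∀ i, HasWeakPartialDeriv Ω i u (Du i)
  second : ∀ i j, HasWeakPartialDeriv Ω i (Du j) (D2u i j)

/-- `a` is a measurable symmetric matrix-valued function with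
`δ |ξ|² ≤ a^{ij}(x) ξ_i ξ_j ≤ δ⁻¹ |ξ|²` for all `x` and `ξ`. -/
structure IsUniformlyElliptic {d : ℕ} (δ : ℝ)
    (a : EuclideanSpace ℝ (Fin d) → Matrix (Fin d) (Fin d) ℝ) : Prop where
  measurable : ∀ i j, Measurable fun x => a x i j
  symm : ∀ x, (a x).IsSymm
  lower : ∀ x ξ : EuclideanSpace ℝ (Fin d), δ * ‖ξ‖ ^ 2 ≤ ∑ i, ∑ j, a x i j * ξ i * ξ j
  upper : ∀ x ξ : EuclideanSpace ℝ (Fin d), ∑ i, ∑ j, a x i j * ξ i * ξ j ≤ δ⁻¹ * ‖ξ‖ ^ 2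

/-- `ℒ u (x) = a^{ij}(x) D_{ij} u (x) + b^i(x) D_i u (x)`, in terms of the (weak) derivatives
`Du` and `D2u` of `u`. -/
noncomputable def ellipticOp {d : ℕ}
    (a : EuclideanSpace ℝ (Fin d) → Matrix (Fin d) (Fin d) ℝ)
    (b : EuclideanSpace ℝ (Fin d) → EuclideanSpace ℝ (Fin d))
    (Du : Fin d → EuclideanSpace ℝ (Fin d) → ℝ)
    (D2u : Fin d → Fin d → EuclideanSpace ℝ (Fin d) → ℝ)
    (x : EuclideanSpace ℝ (Fin d)) : ℝ :=
  ∑ i, ∑ j, a x i j * D2u i j x + ∑ i, b x i * Du i x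

open Filter Topology Convolution

/-! The lower bound comes from comparing `u` with the barrier `ψ(x) = c ρ² η(x/ρ)`, where `η` is a
fixed cutoff: `ψ` equals `c ρ²` on `B_ρ`, vanishes on `∂B_{2ρ}`, and `c`, depending only on `d` and
`δ`, is so small that `-a^{ij} D_{ij} ψ ≤ 1`. Hence `v = u - ψ` satisfies `a^{ij} D_{ij} v ≤ |b|
|Dv| + |b| |Dψ|`, and `Dψ` lives only in the shell `S = B_{2ρ} \ B_ρ`.

The Aleksandrov-Bakelman-Pucci estimate `exists_aleksandrov_const` bounds the loss from the last
term by a multiple of `ρ M ‖b Dψ‖_{L_d(S)}`, with `M` depending on `K`. This dependence is harmless: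
among sufficiently many dyadic shells, one carries so little of `∫ |b|^d` that the loss is at most
`c ρ² / 2` (`exists_shell_lintegral_le`). Only the number of shells, hence `R₀`, depends on `K`; the
bound `c ρ² / 2 ≥ c / 2` does not. On `∂B_{2ρ}` one needs `u ≥ 0`, which is the weak maximum
principle `MemW2.nonneg_of_ellipticOp_eq`, itself a consequence of the same estimate.

The estimate rests on the gradient map. If `w` is smooth and dips far below its boundary values,
then its gradient, restricted to points with nonnegative Hessian, covers a ball
(`ball_subset_image_gradVec`). The area formula, with a weight `h(p)` on gradients, bounds the
integral of `h` over this ball by that of `|det D²w| h(Dw)`. Mollification carries this over to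
`W^2_d`. The weight `(|p|^d + g^d)⁻¹` absorbs the drift, and its divergent integral over the whole
space forces the ball of gradients to be small. -/

/-! ### Mollification and smooth approximation in `W^2_d`. -/

theorem lintegral_pow_le_of_isProbabilityMeasure {α : Type*} [MeasurableSpace α] (P : Measure α)
    [IsProbabilityMeasure P] {f : α → ℝ≥0∞} (hf : AEMeasurable f P) {n : ℕ} (hn : 1 ≤ n) :
    (∫⁻ x, f x ∂P) ^ n ≤ ∫⁻ x, f x ^ n ∂P := by
  have h := eLpNorm'_le_eLpNorm'_of_exponent_le (p := 1) (q := (n : ℝ)) one_pos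
    (by exact_mod_cast hn) P hf.aestronglyMeasurable
  simp only [eLpNorm', enorm_eq_self, ENNReal.rpow_one, one_div, inv_one, ENNReal.rpow_natCast] at h
  have hn0 : (n : ℝ) ≠ 0 := by exact_mod_cast (by omega : n ≠ 0)
  calc (∫⁻ x, f x ∂P) ^ n ≤ ((∫⁻ x, f x ^ n ∂P) ^ ((n : ℝ)⁻¹)) ^ n := by gcongr
    _ = _ := by
      rw [← ENNReal.rpow_natCast, ← ENNReal.rpow_mul, inv_mul_cancel₀ hn0, ENNReal.rpow_one]

/-- Jensen's inequality for the average with respect to a normalized bump function. -/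
theorem ContDiffBump.enorm_integral_normed_mul_pow_le {d : ℕ}
    (φ : ContDiffBump (0 : EuclideanSpace ℝ (Fin d))) {k : EuclideanSpace ℝ (Fin d) → ℝ}
    (hk : AEStronglyMeasurable k volume) {n : ℕ} (hn : 1 ≤ n) :
    ‖∫ t, φ.normed volume t * k t‖ₑ ^ n ≤ ∫⁻ t, ‖φ.normed volume t‖ₑ * ‖k t‖ₑ ^ n := by
  set P : Measure (EuclideanSpace ℝ (Fin d)) :=
    volume.withDensity fun t => ‖φ.normed volume t‖ₑ with hP
  have hm : Measurable fun t => ‖φ.normed volume t‖ₑ := φ.continuous_normed.enorm.measurable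
  have : IsProbabilityMeasure P := by
    constructor
    rw [hP, withDensity_apply _ MeasurableSet.univ, Measure.restrict_univ]
    simp_rw [Real.enorm_of_nonneg (φ.nonneg_normed _)]
    rw [← ofReal_integral_eq_lintegral_ofReal φ.integrable_normed
      (Eventually.of_forall φ.nonneg_normed), φ.integral_normed, ENNReal.ofReal_one]
  have hk' : AEMeasurable (fun t => ‖k t‖ₑ) P :=
    hk.enorm.mono_ac (withDensity_absolutelyContinuous _ _)
  have h1 := lintegral_pow_le_of_isProbabilityMeasure P hk' hn
  rw [hP, lintegral_withDensity_eq_lintegral_mul₀ hm.aemeasurable hk.enorm,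
    lintegral_withDensity_eq_lintegral_mul₀ hm.aemeasurable (hk.enorm.pow_const _)] at h1
  refine le_trans ?_ h1
  gcongr
  refine (enorm_integral_le_lintegral_enorm _).trans_eq ?_
  simp [enorm_mul]

/-- Strong continuity of translations on `L^p` for finite `p`, obtained from the continuity of
composition with a continuous family of measure preserving maps. -/
theorem MeasureTheory.MemLp.exists_eLpNorm_translation_sub_le {d : ℕ}
    {g : EuclideanSpace ℝ (Fin d) → ℝ} {p : ℝ≥0∞} [Fact (1 ≤ p)] (hp : p ≠ ⊤)
    (hg : MemLp g p volume) {ε : ℝ≥0∞} (hε : 0 < ε) :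
    ∃ δ : ℝ, 0 < δ ∧ ∀ t ∈ ball (0 : EuclideanSpace ℝ (Fin d)) δ,
      eLpNorm (fun x => g (x - t) - g x) p volume ≤ ε := by
  let G : C(EuclideanSpace ℝ (Fin d), C(EuclideanSpace ℝ (Fin d), EuclideanSpace ℝ (Fin d))) :=
    (ContinuousMap.mk (fun a : EuclideanSpace ℝ (Fin d) × EuclideanSpace ℝ (Fin d) => a.2 - a.1)
      (by fun_prop)).curry
  have hG : ∀ t, MeasurePreserving (G t) volume volume := fun t =>
    measurePreserving_sub_right volume t
  have hc : Continuous fun t => Lp.compMeasurePreserving (G t) (hG t) (hg.toLp g) :=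
    continuous_const.compMeasurePreservingLp G.continuous hG hp
  have h0 := EMetric.tendsto_nhds.1 (hc.tendsto 0) ε hε
  obtain ⟨δ, hδ, H⟩ := Metric.eventually_nhds_iff_ball.1 h0
  refine ⟨δ, hδ, fun t ht => le_trans (le_of_eq ?_) (H t ht).le⟩
  rw [Lp.edist_def]
  refine eLpNorm_congr_ae ?_
  have e1 : ∀ t, Lp.compMeasurePreserving (G t) (hG t) (hg.toLp g) =ᵐ[volume] fun x => g (x - t) :=
    fun t => (Lp.coeFn_compMeasurePreserving _ (hG t)).trans
      ((hG t).quasiMeasurePreserving.ae_eq_comp hg.coeFn_toLp)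
  filter_upwards [e1 t, e1 0] with x h1 h2
  simp only [Pi.sub_apply, h1, h2, sub_zero]

/-- Mollifications of an `L^n` function converge to it in `L^n`. -/
theorem ContDiffBump.tendsto_lintegral_convolution_sub {d n : ℕ} (hn : 1 ≤ n)
    {φ : ℕ → ContDiffBump (0 : EuclideanSpace ℝ (Fin d))}
    (hφ : Tendsto (fun i => (φ i).rOut) atTop (𝓝 0))
    {g : EuclideanSpace ℝ (Fin d) → ℝ} (hg : MemLp g n volume) :
    Tendsto (fun i => ∫⁻ x, ‖((φ i).normed volume ⋆[ContinuousLinearMap.lsmul ℝ ℝ, volume] g) x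
      - g x‖ₑ ^ n) atTop (𝓝 0) := by
  have : Fact ((1 : ℝ≥0∞) ≤ n) := ⟨by exact_mod_cast hn⟩
  have hn0 : n ≠ 0 := by omega
  have hloc : LocallyIntegrable g volume := hg.locallyIntegrable Fact.out
  rw [ENNReal.tendsto_nhds_zero]
  intro ε hε
  obtain ⟨η, hη, hηε⟩ : ∃ η : ℝ≥0∞, 0 < η ∧ η ^ n ≤ ε := by
    refine ⟨ε ^ ((n : ℝ)⁻¹), ENNReal.rpow_pos_of_nonneg hε (by positivity), ?_⟩
    rw [← ENNReal.rpow_natCast, ← ENNReal.rpow_mul, inv_mul_cancel₀ (by exact_mod_cast hn0),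
      ENNReal.rpow_one]
  obtain ⟨δ, hδ, H⟩ := hg.exists_eLpNorm_translation_sub_le (ENNReal.natCast_ne_top n) hη
  filter_upwards [hφ.eventually_lt_const hδ] with i hi
  -- Jensen moves the power inside the average over shifts `t`. Tonelli then reduces the claim to
  -- shifts within the support of the mollifier, where translation changes `g` little.
  have hpt : ∀ x, ‖((φ i).normed volume ⋆[ContinuousLinearMap.lsmul ℝ ℝ, volume] g) x - g x‖ₑ ^ n ≤
      ∫⁻ t, ‖(φ i).normed volume t‖ₑ * ‖g (x - t) - g x‖ₑ ^ n := by
    intro x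
    have hint : Integrable (fun t => (φ i).normed volume t * g (x - t)) volume := by
      have := (φ i).hasCompactSupport_normed (μ := volume) |>.convolutionExists_left
        (ContinuousLinearMap.lsmul ℝ ℝ) (φ i).continuous_normed hloc x
      simpa [ConvolutionExistsAt] using this
    have e : ((φ i).normed volume ⋆[ContinuousLinearMap.lsmul ℝ ℝ, volume] g) x - g x =
        ∫ t, (φ i).normed volume t * (g (x - t) - g x) := by
      simp_rw [mul_sub]
      rw [integral_sub hint ((φ i).integrable_normed.mul_const _), integral_mul_const,
        (φ i).integral_normed, one_mul]
      simp [convolution_def]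
    rw [e]
    refine (φ i).enorm_integral_normed_mul_pow_le ?_ hn
    exact (hg.aestronglyMeasurable.comp_measurePreserving
      (Measure.measurePreserving_sub_left volume x)).sub aestronglyMeasurable_const
  have hsq : ∀ t, ‖(φ i).normed volume t‖ₑ * ∫⁻ x, ‖g (x - t) - g x‖ₑ ^ n ≤
      ‖(φ i).normed volume t‖ₑ * η ^ n := by
    intro t
    by_cases ht : t ∈ ball (0 : EuclideanSpace ℝ (Fin d)) (φ i).rOut
    · gcongr
      have h2 := H t (ball_subset_ball hi.le ht)
      rw [eLpNorm_eq_lintegral_rpow_enorm_toReal (by exact_mod_cast hn0) (by simp)] at h2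
      simp only [ENNReal.toReal_natCast, ENNReal.rpow_natCast, one_div] at h2
      calc _ = ((∫⁻ x, ‖g (x - t) - g x‖ₑ ^ n) ^ ((n : ℝ)⁻¹)) ^ n := by
            rw [← ENNReal.rpow_natCast, ← ENNReal.rpow_mul,
              inv_mul_cancel₀ (by exact_mod_cast hn0), ENNReal.rpow_one]
        _ ≤ _ := by gcongr
    · rw [← (φ i).support_normed_eq (μ := volume), Function.notMem_support] at ht
      simp [ht]
  calc _ ≤ ∫⁻ x, ∫⁻ t, ‖(φ i).normed volume t‖ₑ * ‖g (x - t) - g x‖ₑ ^ n := lintegral_mono hpt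
    _ = ∫⁻ t, ∫⁻ x, ‖(φ i).normed volume t‖ₑ * ‖g (x - t) - g x‖ₑ ^ n := by
      refine lintegral_lintegral_swap ?_
      have h1 : AEStronglyMeasurable
          (fun z : EuclideanSpace ℝ (Fin d) × EuclideanSpace ℝ (Fin d) => g (z.1 - z.2))
          (volume.prod volume) := hg.aestronglyMeasurable.comp_quasiMeasurePreserving
            (quasiMeasurePreserving_sub_of_right_invariant volume volume)
      have h2 : AEStronglyMeasurable
          (fun z : EuclideanSpace ℝ (Fin d) × EuclideanSpace ℝ (Fin d) => g z.1)
          (volume.prod volume) := hg.aestronglyMeasurable.comp_fst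
      have h3 : Measurable
          (fun z : EuclideanSpace ℝ (Fin d) × EuclideanSpace ℝ (Fin d) =>
            ‖(φ i).normed volume z.2‖ₑ) :=
        (φ i).continuous_normed.enorm.measurable.comp measurable_snd
      exact h3.aemeasurable.mul ((h1.sub h2).enorm.pow_const _)
    _ = ∫⁻ t, ‖(φ i).normed volume t‖ₑ * ∫⁻ x, ‖g (x - t) - g x‖ₑ ^ n := by
      refine lintegral_congr fun t => lintegral_const_mul' _ _ enorm_ne_top
    _ ≤ ∫⁻ t, ‖(φ i).normed volume t‖ₑ * η ^ n := lintegral_mono hsq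
    _ = η ^ n := by
      rw [lintegral_mul_const _ (φ i).continuous_normed.enorm.measurable]
      simp_rw [Real.enorm_of_nonneg ((φ i).nonneg_normed _)]
      rw [← ofReal_integral_eq_lintegral_ofReal (φ i).integrable_normed
        (Eventually.of_forall (φ i).nonneg_normed), (φ i).integral_normed, ENNReal.ofReal_one,
        one_mul]
    _ ≤ ε := hηε

/-- The partial derivative `∂ᵢ f`. -/
noncomputable def partialDeriv {d : ℕ} (i : Fin d) (f : EuclideanSpace ℝ (Fin d) → ℝ)
    (x : EuclideanSpace ℝ (Fin d)) : ℝ :=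
  fderiv ℝ f x (EuclideanSpace.single i 1)

theorem Filter.EventuallyEq.partialDeriv_eq {d : ℕ} {i : Fin d}
    {f g : EuclideanSpace ℝ (Fin d) → ℝ} {x : EuclideanSpace ℝ (Fin d)} (h : f =ᶠ[𝓝 x] g) :
    partialDeriv i f x = partialDeriv i g x := by
  simp only [partialDeriv, h.fderiv_eq]

theorem ContDiff.partialDeriv {d : ℕ} {i : Fin d} {f : EuclideanSpace ℝ (Fin d) → ℝ}
    (hf : ContDiff ℝ ∞ f) : ContDiff ℝ ∞ (partialDeriv i f) :=
  (hf.fderiv_right (m := ∞) le_rfl).clm_apply contDiff_const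

/-- Differentiating a mollification amounts to mollifying the weak derivative. -/
theorem HasWeakPartialDeriv.partialDeriv_convolution {d : ℕ} {Ω : Set (EuclideanSpace ℝ (Fin d))}
    {i : Fin d} {u g : EuclideanSpace ℝ (Fin d) → ℝ} (h : HasWeakPartialDeriv Ω i u g)
    (hΩ : MeasurableSet Ω) (hu : LocallyIntegrable (Ω.indicator u) volume)
    (φ : ContDiffBump (0 : EuclideanSpace ℝ (Fin d))) {x : EuclideanSpace ℝ (Fin d)}
    (hx : closedBall x φ.rOut ⊆ Ω) :
    partialDeriv i (φ.normed volume ⋆[ContinuousLinearMap.lsmul ℝ ℝ, volume] Ω.indicator u) x =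
      (φ.normed volume ⋆[ContinuousLinearMap.lsmul ℝ ℝ, volume] Ω.indicator g) x := by
  have hcs := φ.hasCompactSupport_normed (μ := volume)
  have hcd : ContDiff ℝ 1 (φ.normed volume) := φ.contDiff_normed
  have hD := (hcs.hasFDerivAt_convolution_left (ContinuousLinearMap.lsmul ℝ ℝ) hcd hu x).fderiv
  have hint := (hcs.fderiv ℝ).convolutionExists_left
    ((ContinuousLinearMap.lsmul ℝ ℝ).precompL (EuclideanSpace ℝ (Fin d)))
    (hcd.continuous_fderiv one_ne_zero) hu x
  have hψd : ∀ y, fderiv ℝ (fun y => φ.normed volume (x - y)) y =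
      - fderiv ℝ (φ.normed volume) (x - y) := by
    intro y
    have h1 : HasFDerivAt (fun y => x - y)
        (-ContinuousLinearMap.id ℝ (EuclideanSpace ℝ (Fin d))) y := by
      simpa using (hasFDerivAt_id y).const_sub x
    have h2 := ((hcd.differentiable one_ne_zero) (x - y)).hasFDerivAt.comp y h1
    have h3 := h2.fderiv
    simp only [Function.comp_def] at h3
    rw [h3]
    ext; simp
  -- The reflected mollifier is the test function; the minus sign in `hψd` cancels the one in the
  -- definition of the weak derivative.
  have hψ : IsTestFunction Ω fun y => φ.normed volume (x - y) := by
    have hts : tsupport (fun y => φ.normed volume (x - y)) ⊆ closedBall x φ.rOut := by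
      refine closure_minimal (fun y hy => ?_) isClosed_closedBall
      have : x - y ∈ Function.support (φ.normed volume) := hy
      rw [φ.support_normed_eq, mem_ball_zero_iff] at this
      rw [mem_closedBall, dist_comm, dist_eq_norm]
      exact this.le
    refine ⟨φ.contDiff_normed.comp (contDiff_const.sub contDiff_id), ?_, hts.trans hx⟩
    exact (isCompact_closedBall x φ.rOut).of_isClosed_subset (isClosed_tsupport _) hts
  have key := h.integral_eq _ hψ
  unfold partialDeriv
  rw [hD, convolution_def, ContinuousLinearMap.integral_apply hint, convolution_def]
  rw [← integral_sub_left_eq_self _ volume x, ← integral_sub_left_eq_self (fun t =>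
    ContinuousLinearMap.lsmul ℝ ℝ (φ.normed volume t) (Ω.indicator g (x - t))) volume x]
  simp only [ContinuousLinearMap.precompL_apply, sub_sub_cancel, ContinuousLinearMap.lsmul_apply,
    smul_eq_mul, hψd, neg_apply, mul_neg, integral_neg, neg_inj] at key ⊢
  rw [← integral_indicator hΩ, ← integral_indicator hΩ] at key
  refine Eq.trans (integral_congr_ae (Eventually.of_forall fun y => ?_))
    (key.trans (integral_congr_ae (Eventually.of_forall fun y => ?_))) <;>
  by_cases hy : y ∈ Ω <;> simp [hy, mul_comm]

/-- A sequence of smooth functions that approximates `v`, with prospective first derivatives `Dv`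
and second derivatives `D2v`: uniformly in the closed ball of radius `r`, almost everywhere for the
gradient, and in `L^d` for the Hessian. -/
structure IsSmoothApprox {d : ℕ} (r : ℝ) (w : ℕ → EuclideanSpace ℝ (Fin d) → ℝ)
    (v : EuclideanSpace ℝ (Fin d) → ℝ) (Dv : Fin d → EuclideanSpace ℝ (Fin d) → ℝ)
    (D2v : Fin d → Fin d → EuclideanSpace ℝ (Fin d) → ℝ) : Prop where
  contDiff : ∀ n, ContDiff ℝ ∞ (w n)
  tendstoUniformlyOn : TendstoUniformlyOn w v atTop (closedBall 0 r)
  tendsto_first : ∀ i, ∀ᵐ x ∂(volume.restrict (ball 0 r)),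
    Tendsto (fun n => partialDeriv i (w n) x) atTop (𝓝 (Dv i x))
  tendsto_second : ∀ i j, Tendsto
    (fun n => ∫⁻ x in ball 0 r, ‖partialDeriv i (partialDeriv j (w n)) x - D2v i j x‖ₑ ^ d)
    atTop (𝓝 0)

/-- The standard mollifiers, with support in the ball of radius `2 / (n + 1)`. -/
noncomputable def stdMollifier (d n : ℕ) : ContDiffBump (0 : EuclideanSpace ℝ (Fin d)) where
  rIn := 1 / ((n : ℝ) + 1)
  rOut := 2 * (1 / ((n : ℝ) + 1))
  rIn_pos := by positivity
  rIn_lt_rOut := lt_mul_of_one_lt_left (by positivity) one_lt_two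

theorem tendsto_stdMollifier_rOut (d : ℕ) :
    Tendsto (fun n => (stdMollifier d n).rOut) atTop (𝓝 0) := by
  simpa [stdMollifier] using tendsto_one_div_add_atTop_nhds_zero_nat.const_mul (2 : ℝ)

/-- A function in `W^2_d` of a ball has smooth approximations in every smaller ball. -/
theorem MemW2.exists_isSmoothApprox {d : ℕ} (hd : 1 ≤ d) {R r : ℝ} (hrR : r < R)
    {u : EuclideanSpace ℝ (Fin d) → ℝ} {Du : Fin d → EuclideanSpace ℝ (Fin d) → ℝ}
    {D2u : Fin d → Fin d → EuclideanSpace ℝ (Fin d) → ℝ} (hu : MemW2 (ball 0 R) d u Du D2u)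
    (huc : ContinuousOn u (closedBall 0 R)) : ∃ w, IsSmoothApprox r w u Du D2u := by
  have hB : MeasurableSet (ball (0 : EuclideanSpace ℝ (Fin d)) R) := measurableSet_ball
  have hd1 : (1 : ℝ≥0∞) ≤ d := by exact_mod_cast hd
  have hmem : ∀ {f : EuclideanSpace ℝ (Fin d) → ℝ}, MemLp f d (volume.restrict (ball 0 R)) →
      MemLp ((ball 0 R).indicator f) d volume := fun hf => (memLp_indicator_iff_restrict hB).2 hf
  have hloc : ∀ {f : EuclideanSpace ℝ (Fin d) → ℝ}, MemLp f d (volume.restrict (ball 0 R)) →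
      LocallyIntegrable ((ball 0 R).indicator f) volume := fun hf => (hmem hf).locallyIntegrable hd1
  -- Once the mollifier radius is below `R - r`, values in the ball of radius `r` do not see the
  -- extension by zero.
  have hev : ∀ᶠ n in atTop, (stdMollifier d n).rOut < R - r :=
    (tendsto_stdMollifier_rOut d).eventually_lt_const (sub_pos.2 hrR)
  have hsub : ∀ {n} {x : EuclideanSpace ℝ (Fin d)}, (stdMollifier d n).rOut < R - r →
      x ∈ closedBall 0 r → closedBall x (stdMollifier d n).rOut ⊆ ball 0 R := by
    intro n x hn hx
    refine closedBall_subset_ball' ?_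
    rw [mem_closedBall] at hx
    linarith
  let w : ℕ → EuclideanSpace ℝ (Fin d) → ℝ := fun n =>
    (stdMollifier d n).normed volume ⋆[ContinuousLinearMap.lsmul ℝ ℝ, volume] (ball 0 R).indicator u
  have hfirst : ∀ i n x, (stdMollifier d n).rOut < R - r → x ∈ closedBall 0 r →
      partialDeriv i (w n) x = ((stdMollifier d n).normed volume
        ⋆[ContinuousLinearMap.lsmul ℝ ℝ, volume] (ball 0 R).indicator (Du i)) x :=
    fun i n x hn hx => (hu.first i).partialDeriv_convolution hB (hloc hu.memLp) _ (hsub hn hx)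
  have hsecond : ∀ i j n x, (stdMollifier d n).rOut < R - r → x ∈ ball 0 r →
      partialDeriv i (partialDeriv j (w n)) x = ((stdMollifier d n).normed volume
        ⋆[ContinuousLinearMap.lsmul ℝ ℝ, volume] (ball 0 R).indicator (D2u i j)) x := by
    intro i j n x hn hx
    rw [← (hu.second i j).partialDeriv_convolution hB (hloc (hu.memLp_first j)) _
      (hsub hn (ball_subset_closedBall hx))]
    refine Filter.EventuallyEq.partialDeriv_eq ?_
    filter_upwards [isOpen_ball.mem_nhds hx] with y hy
    exact hfirst j n y hn (ball_subset_closedBall hy)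
  refine ⟨w, fun n => ?_, ?_, fun i => ?_, fun i j => ?_⟩
  · exact (stdMollifier d n).hasCompactSupport_normed.contDiff_convolution_left _
      (stdMollifier d n).contDiff_normed (hloc hu.memLp)
  · rw [Metric.tendstoUniformlyOn_iff]
    intro ε hε
    have huu := (isCompact_closedBall (0 : EuclideanSpace ℝ (Fin d)) R).uniformContinuousOn_of_continuous
      huc
    obtain ⟨δ, hδ, H⟩ := Metric.uniformContinuousOn_iff.1 huu (ε / 2) (half_pos hε)
    filter_upwards [hev, (tendsto_stdMollifier_rOut d).eventually_lt_const hδ] with n hn hn' x hx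
    have hxs := hsub hn hx
    have hxR : x ∈ ball (0 : EuclideanSpace ℝ (Fin d)) R :=
      hxs (mem_closedBall_self (stdMollifier d n).rOut_pos.le)
    have := (stdMollifier d n).dist_normed_convolution_le (x₀ := x) (ε := ε / 2)
      (hloc hu.memLp).aestronglyMeasurable (fun y hy => by
        have hyR := hxs (ball_subset_closedBall hy)
        rw [Set.indicator_of_mem hyR, Set.indicator_of_mem hxR]
        exact (H y (ball_subset_closedBall hyR) x (ball_subset_closedBall hxR)
          ((mem_ball.1 hy).trans hn')).le)
    rw [Set.indicator_of_mem hxR] at this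
    rw [dist_comm]
    exact this.trans_lt (half_lt_self hε)
  -- Lebesgue differentiation gives convergence along the whole sequence; `K = 2` is the fixed ratio
  -- of outer to inner radius.
  · have hae := ContDiffBump.ae_convolution_tendsto_right_of_locallyIntegrable (K := 2)
      (tendsto_stdMollifier_rOut d) (Eventually.of_forall fun n => le_rfl)
      (hloc (hu.memLp_first i))
    filter_upwards [ae_restrict_of_ae hae, ae_restrict_mem measurableSet_ball] with x hx hxr
    rw [Set.indicator_of_mem (ball_subset_ball hrR.le hxr)] at hx
    refine hx.congr' ?_
    filter_upwards [hev] with n hn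
    exact (hfirst i n x hn (ball_subset_closedBall hxr)).symm
  · refine tendsto_of_tendsto_of_tendsto_of_le_of_le' tendsto_const_nhds
      (ContDiffBump.tendsto_lintegral_convolution_sub hd (tendsto_stdMollifier_rOut d)
        (hmem (hu.memLp_second i j))) (Eventually.of_forall fun n => zero_le) ?_
    filter_upwards [hev] with n hn
    refine le_trans ?_ (setLIntegral_le_lintegral (ball 0 r) _)
    refine le_of_eq (setLIntegral_congr_fun measurableSet_ball fun x hx => ?_)
    simp only [hsecond i j n x hn hx, Set.indicator_of_mem (ball_subset_ball hrR.le hx)]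

/-! ### Matrix inequalities and uniform ellipticity. -/

namespace Matrix

open scoped MatrixOrder in
-- With `B = Cᴴ C`, cyclicity of the trace turns `tr (A B)` into `tr (C A Cᴴ)`.
theorem PosSemidef.trace_mul_nonneg {n : Type*} [Fintype n] {A B : Matrix n n ℝ}
    (hA : A.PosSemidef) (hB : B.PosSemidef) : 0 ≤ (A * B).trace := by
  classical
  obtain ⟨C, rfl⟩ := CStarAlgebra.nonneg_iff_eq_star_mul_self.1 hB.nonneg
  rw [Matrix.star_eq_conjTranspose, ← Matrix.mul_assoc, Matrix.trace_mul_comm, ← Matrix.mul_assoc]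
  exact (hA.mul_mul_conjTranspose_same C).trace_nonneg

/-- Each eigenvalue is nonnegative, hence at most the trace. This replaces the arithmetic-geometric
mean inequality, whose sharp constant plays no role. -/
theorem PosSemidef.det_le_trace_pow {n : Type*} [Fintype n] [DecidableEq n] {A : Matrix n n ℝ}
    (hA : A.PosSemidef) : A.det ≤ A.trace ^ Fintype.card n := by
  have hd := hA.isHermitian.det_eq_prod_eigenvalues
  have ht := hA.isHermitian.trace_eq_sum_eigenvalues
  simp only [RCLike.ofReal_real_eq_id, id_eq] at hd ht
  rw [hd, ht, ← Finset.card_univ, ← Finset.prod_const]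
  exact Finset.prod_le_prod (fun i _ => hA.eigenvalues_nonneg i) fun i _ =>
    Finset.single_le_sum (f := hA.isHermitian.eigenvalues)
      (fun j _ => hA.eigenvalues_nonneg j) (Finset.mem_univ i)

end Matrix

namespace IsUniformlyElliptic

variable {d : ℕ} {δ : ℝ} {a : EuclideanSpace ℝ (Fin d) → Matrix (Fin d) (Fin d) ℝ}

theorem posSemidef_sub (ha : IsUniformlyElliptic δ a) (x : EuclideanSpace ℝ (Fin d)) :
    (a x - δ • (1 : Matrix (Fin d) (Fin d) ℝ)).PosSemidef := by
  refine .of_dotProduct_mulVec_nonneg ?_ fun y => ?_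
  · have := ha.symm x
    rw [Matrix.IsSymm] at this
    simp [Matrix.IsHermitian, this]
  · have h := ha.lower x (WithLp.toLp 2 y)
    rw [EuclideanSpace.real_norm_sq_eq] at h
    simp only [star_trivial, Matrix.sub_mulVec, Matrix.smul_mulVec, Matrix.one_mulVec,
      dotProduct_sub, dotProduct_smul, smul_eq_mul]
    have e1 : y ⬝ᵥ y = ∑ i, y i ^ 2 := by simp [dotProduct, sq]
    have e2 : y ⬝ᵥ (a x).mulVec y = ∑ i, ∑ j, a x i j * y i * y j := by
      simp only [dotProduct, Matrix.mulVec, Finset.mul_sum]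
      exact Finset.sum_congr rfl fun i _ => Finset.sum_congr rfl fun j _ => by ring
    rw [e1, e2]
    simpa using h

/-- The trace of the product of the positive semidefinite matrices `a x - δ` and `H` is nonnegative.
-/
theorem mul_trace_le (ha : IsUniformlyElliptic δ a) (x : EuclideanSpace ℝ (Fin d))
    {H : Matrix (Fin d) (Fin d) ℝ} (hH : H.PosSemidef) :
    δ * H.trace ≤ ∑ i, ∑ j, a x i j * H i j := by
  have h := (ha.posSemidef_sub x).trace_mul_nonneg hH
  rw [Matrix.sub_mul, Matrix.trace_sub, Matrix.smul_mul, Matrix.one_mul, Matrix.trace_smul,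
    smul_eq_mul, sub_nonneg] at h
  refine h.trans_eq ?_
  simp only [Matrix.trace, Matrix.diag, Matrix.mul_apply]
  refine Finset.sum_congr rfl fun i _ => Finset.sum_congr rfl fun j _ => ?_
  have := hH.isHermitian.apply i j
  simp only [star_trivial] at this
  rw [this]

/-- Nonnegativity of the form at `e_i ± e_j` gives `2 |a_ij| ≤ a_ii + a_jj`, and the upper
ellipticity bound controls the diagonal. -/
theorem abs_apply_le (hδ : 0 < δ) (ha : IsUniformlyElliptic δ a) (x : EuclideanSpace ℝ (Fin d))
    (i j : Fin d) : |a x i j| ≤ δ⁻¹ := by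
  have hsymm : a x j i = a x i j := (ha.symm x).apply i j
  have key : ∀ i j, ∀ s : ℝ, 0 ≤ a x i i + s * (a x i j + a x j i) + s ^ 2 * a x j j := by
    intro i j s
    have h := (mul_nonneg hδ.le (sq_nonneg _)).trans
      (ha.lower x (EuclideanSpace.single i 1 + s • EuclideanSpace.single j 1))
    simp [mul_add, add_mul, Finset.sum_add_distrib] at h
    linarith
  have hdiag : ∀ i, a x i i ≤ δ⁻¹ := by
    intro i
    have h := ha.upper x (EuclideanSpace.single i 1)
    simpa [Pi.single_apply] using h
  have h1 := key i j 1
  have h2 := key i j (-1)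
  rw [hsymm] at h1 h2
  rw [abs_le]
  constructor <;> linarith [hdiag i, hdiag j]

end IsUniformlyElliptic

/-! ### Contact points and the gradient map of smooth functions. -/

/-- The necessary second order condition at an interior minimum of `w - ℓ`. -/
theorem IsLocalMin.fderiv_fderiv_nonneg {V : Type*} [NormedAddCommGroup V] [NormedSpace ℝ V]
    {w : V → ℝ} (hw : ContDiff ℝ ∞ w) {ℓ : V →L[ℝ] ℝ} {x : V}
    (h : IsLocalMin (fun y => w y - ℓ y) x) :
    fderiv ℝ w x = ℓ ∧ ∀ ξ, 0 ≤ fderiv ℝ (fderiv ℝ w) x ξ ξ := by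
  have hdiff : Differentiable ℝ w := hw.differentiable (by simp)
  have hdiff2 : Differentiable ℝ (fderiv ℝ w) :=
    (hw.fderiv_right (m := ∞) le_rfl).differentiable (by simp)
  have hF : ∀ y, HasFDerivAt (fun y => w y - ℓ y) (fderiv ℝ w y - ℓ) y := fun y =>
    (hdiff y).hasFDerivAt.sub ℓ.hasFDerivAt
  have h0 : fderiv ℝ w x = ℓ := by
    have := h.fderiv_eq_zero
    rw [(hF x).fderiv] at this
    exact sub_eq_zero.1 this
  refine ⟨h0, fun ξ => ?_⟩
  -- Along a line with negative second derivative the point would also be a local maximum, so the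
  -- restriction would be locally constant and its second derivative zero.
  by_contra! hneg
  have hline : ∀ t : ℝ, HasDerivAt (fun t : ℝ => x + t • ξ) ξ t := fun t => by
    simpa using ((hasDerivAt_id t).smul_const ξ).const_add x
  let g : ℝ → ℝ := fun t => w (x + t • ξ) - ℓ (x + t • ξ)
  have hg1 : ∀ t, HasDerivAt g ((fderiv ℝ w (x + t • ξ) - ℓ) ξ) t := fun t =>
    HasFDerivAt.comp_hasDerivAt (f := fun t : ℝ => x + t • ξ) t (hF (x + t • ξ)) (hline t)
  have hg1' : deriv g = fun t => (fderiv ℝ w (x + t • ξ) - ℓ) ξ := funext fun t => (hg1 t).deriv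
  have hg2 : HasDerivAt (deriv g) (fderiv ℝ (fderiv ℝ w) x ξ ξ) 0 := by
    rw [hg1']
    have := ((hdiff2 (x + (0 : ℝ) • ξ)).hasFDerivAt.comp_hasDerivAt (0 : ℝ) (hline 0)).sub_const ℓ
    simpa using this.clm_apply (hasDerivAt_const (0 : ℝ) ξ)
  have hg0 : deriv g 0 = 0 := by simp [hg1', h0]
  have hmax : IsLocalMax g 0 :=
    isLocalMax_of_deriv_deriv_neg (by rw [hg2.deriv]; exact hneg) hg0 (hg1 0).continuousAt
  have hmin : IsLocalMin g 0 := by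
    have hc : ContinuousAt (fun t : ℝ => x + t • ξ) 0 := (hline 0).continuousAt
    have h' : IsLocalMin (fun y => w y - ℓ y) (x + (0 : ℝ) • ξ) := by simpa using h
    exact hc.eventually h'
  have hconst : g =ᶠ[𝓝 0] fun _ => g 0 := by
    filter_upwards [hmax, hmin] with t h1 h2 using le_antisymm h1 h2
  have : deriv (deriv g) 0 = 0 := by
    rw [hconst.deriv.deriv_eq]
    simp
  rw [hg2.deriv] at this
  exact hneg.ne this

/-- The gradient of a function. -/
noncomputable def gradVec {d : ℕ} (w : EuclideanSpace ℝ (Fin d) → ℝ)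
    (x : EuclideanSpace ℝ (Fin d)) : EuclideanSpace ℝ (Fin d) :=
  WithLp.toLp 2 fun i => partialDeriv i w x

/-- The Hessian matrix of a function. -/
noncomputable def hessMatrix {d : ℕ} (w : EuclideanSpace ℝ (Fin d) → ℝ)
    (x : EuclideanSpace ℝ (Fin d)) : Matrix (Fin d) (Fin d) ℝ :=
  Matrix.of fun i j => partialDeriv i (partialDeriv j w) x

section Smooth

variable {d : ℕ} {w : EuclideanSpace ℝ (Fin d) → ℝ}

theorem hessMatrix_apply_eq (hw : ContDiff ℝ ∞ w) (x : EuclideanSpace ℝ (Fin d)) (i j : Fin d) :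
    hessMatrix w x i j =
      fderiv ℝ (fderiv ℝ w) x (EuclideanSpace.single i 1) (EuclideanSpace.single j 1) := by
  have hdiff2 : Differentiable ℝ (fderiv ℝ w) :=
    (hw.fderiv_right (m := ∞) le_rfl).differentiable (by simp)
  have h := ((hdiff2 x).hasFDerivAt.clm_apply
    (hasFDerivAt_const (EuclideanSpace.single j (1 : ℝ)) x)).fderiv
  simp only [hessMatrix, Matrix.of_apply]
  change fderiv ℝ (fun y => fderiv ℝ w y (EuclideanSpace.single j 1)) x _ = _
  rw [h]
  simp

theorem hessMatrix_symm (hw : ContDiff ℝ ∞ w) (x : EuclideanSpace ℝ (Fin d)) (i j : Fin d) :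
    hessMatrix w x i j = hessMatrix w x j i := by
  rw [hessMatrix_apply_eq hw, hessMatrix_apply_eq hw]
  exact (hw.contDiffAt.isSymmSndFDerivAt (by simpa using ENat.LEInfty.out)) _ _

theorem hessMatrix_posSemidef (hw : ContDiff ℝ ∞ w) {x : EuclideanSpace ℝ (Fin d)}
    (h : ∀ ξ, 0 ≤ fderiv ℝ (fderiv ℝ w) x ξ ξ) : (hessMatrix w x).PosSemidef := by
  refine .of_dotProduct_mulVec_nonneg (Matrix.IsHermitian.ext fun i j => ?_) fun y => ?_
  · simpa using hessMatrix_symm hw x j i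
  · refine (h (∑ i, y i • EuclideanSpace.single i 1)).trans_eq ?_
    simp only [star_trivial, dotProduct, Matrix.mulVec, hessMatrix_apply_eq hw, map_sum, map_smul,
      sum_apply, smul_apply, smul_eq_mul,
      Finset.mul_sum]
    refine Finset.sum_congr rfl fun i _ => Finset.sum_congr rfl fun j _ => ?_
    rw [← hessMatrix_apply_eq hw, ← hessMatrix_apply_eq hw, hessMatrix_symm hw x i j]
    ring

theorem contDiff_gradVec (hw : ContDiff ℝ ∞ w) : ContDiff ℝ ∞ (gradVec w) :=
  contDiff_euclidean.2 fun _ => hw.partialDeriv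

theorem det_fderiv_gradVec (hw : ContDiff ℝ ∞ w) (x : EuclideanSpace ℝ (Fin d)) :
    (fderiv ℝ (gradVec w) x).det = (hessMatrix w x).det := by
  have hdiff : DifferentiableAt ℝ (gradVec w) x :=
    ((contDiff_gradVec hw).differentiable (by simp)) x
  rw [ContinuousLinearMap.det, ← LinearMap.det_toMatrix (EuclideanSpace.basisFun (Fin d) ℝ).toBasis,
    ← Matrix.det_transpose]
  congr 1
  ext i j
  have hj := (hasFDerivWithinAt_euclidean.1 (hdiff.hasFDerivAt.hasFDerivWithinAt (s := Set.univ)) j)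
  rw [hasFDerivWithinAt_univ] at hj
  have hj' : fderiv ℝ (partialDeriv j w) x = _ := hj.fderiv
  simp [LinearMap.toMatrix_apply, hessMatrix, partialDeriv, hj']

/-- The **Aleksandrov maximum principle** for smooth functions: the gradient of `w` at its points of
convexity covers the ball of radius `s`, if `w` has a value less than `β - 2rs`. -/
theorem ball_subset_image_gradVec (hw : ContDiff ℝ ∞ w) {r s β : ℝ}
    (hβ : ∀ x ∈ sphere (0 : EuclideanSpace ℝ (Fin d)) r, β ≤ w x) {x₀ : EuclideanSpace ℝ (Fin d)}
    (hx₀ : x₀ ∈ ball (0 : EuclideanSpace ℝ (Fin d)) r) (hlt : w x₀ < β - 2 * r * s) :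
    ball (0 : EuclideanSpace ℝ (Fin d)) s ⊆
      gradVec w '' {x ∈ ball 0 r | ∀ ξ, 0 ≤ fderiv ℝ (fderiv ℝ w) x ξ ξ} := by
  intro p hp
  rw [mem_ball_zero_iff] at hp hx₀
  have hr : 0 < r := (norm_nonneg _).trans_lt hx₀
  -- Tilting by `p` changes values on the closed ball by at most `‖p‖ r < s r`. The gap `2rs`
  -- therefore keeps the minimum of `F` off the sphere, and at an interior minimum the gradient of
  -- `w` is `p`.
  let F : EuclideanSpace ℝ (Fin d) → ℝ := fun y => w y - innerSL ℝ p y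
  have hFc : Continuous F := hw.continuous.sub (innerSL ℝ p).continuous
  obtain ⟨x, hx, hmin⟩ := (isCompact_closedBall (0 : EuclideanSpace ℝ (Fin d)) r).exists_isMinOn
    ⟨x₀, by simpa using hx₀.le⟩ hFc.continuousOn
  have hxb : x ∈ ball (0 : EuclideanSpace ℝ (Fin d)) r := by
    rw [mem_closedBall_zero_iff] at hx
    rw [mem_ball_zero_iff]
    refine lt_of_le_of_ne hx fun hxr => ?_
    have h1 : F x ≤ F x₀ := hmin (by simpa using hx₀.le)
    have h2 := hβ x (by simpa using hxr)
    have h3 := real_inner_le_norm p x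
    have h4 := (abs_le.1 (abs_real_inner_le_norm p x₀)).1
    have h5 : ‖p‖ * ‖x₀‖ ≤ ‖p‖ * r := by gcongr
    have h6 : ‖p‖ * r < s * r := by gcongr
    simp only [F, innerSL_apply_apply] at h1
    rw [hxr] at h3
    linarith
  have hloc : IsLocalMin F x := hmin.isLocalMin
    (mem_of_superset (isOpen_ball.mem_nhds hxb) ball_subset_closedBall)
  obtain ⟨h1, h2⟩ := hloc.fderiv_fderiv_nonneg hw
  refine ⟨x, ⟨hxb, h2⟩, ?_⟩
  ext i
  simp [gradVec, partialDeriv, h1, EuclideanSpace.inner_single_right]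

/-- The area formula in weighted form. It is proved as an inequality of measures, Lebesgue measure
on the ball against the push-forward of `|det D²w|`, so that any weight `h` can then be integrated.
-/
theorem lintegral_ball_le_of_contDiff (hw : ContDiff ℝ ∞ w) {r s β : ℝ}
    (hβ : ∀ x ∈ sphere (0 : EuclideanSpace ℝ (Fin d)) r, β ≤ w x) {x₀ : EuclideanSpace ℝ (Fin d)}
    (hx₀ : x₀ ∈ ball (0 : EuclideanSpace ℝ (Fin d)) r) (hlt : w x₀ < β - 2 * r * s)
    {h : EuclideanSpace ℝ (Fin d) → ℝ≥0∞} (hh : Measurable h) :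
    ∫⁻ p in ball 0 s, h p ≤
      ∫⁻ x in {x ∈ ball 0 r | ∀ ξ, 0 ≤ fderiv ℝ (fderiv ℝ w) x ξ ξ},
        ENNReal.ofReal |(hessMatrix w x).det| * h (gradVec w x) := by
  set Γ := {x ∈ ball (0 : EuclideanSpace ℝ (Fin d)) r | ∀ ξ, 0 ≤ fderiv ℝ (fderiv ℝ w) x ξ ξ}
  have hG : ContDiff ℝ ∞ (gradVec w) := contDiff_gradVec hw
  have hGm : Measurable (gradVec w) := hG.continuous.measurable
  have hc2 : Continuous (fderiv ℝ (fderiv ℝ w)) :=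
    (hw.fderiv_right (m := ∞) le_rfl).continuous_fderiv (by simp)
  have hΓ : MeasurableSet Γ := by
    refine measurableSet_ball.inter (IsClosed.measurableSet ?_)
    change IsClosed {x : EuclideanSpace ℝ (Fin d) | ∀ ξ, 0 ≤ fderiv ℝ (fderiv ℝ w) x ξ ξ}
    rw [Set.ofPred_forall]
    exact isClosed_iInter fun ξ => isClosed_le continuous_const (by fun_prop)
  have hdet : Measurable fun x => ENNReal.ofReal |(hessMatrix w x).det| := by
    simp_rw [← det_fderiv_gradVec hw]
    exact ((ContinuousLinearMap.continuous_det.comp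
      (hG.continuous_fderiv (by simp))).abs.measurable).ennreal_ofReal
  have hle : (volume.restrict (ball (0 : EuclideanSpace ℝ (Fin d)) s)) ≤
      Measure.map (gradVec w)
        ((volume.restrict Γ).withDensity fun x => ENNReal.ofReal |(hessMatrix w x).det|) := by
    refine Measure.le_iff.2 fun T hT => ?_
    rw [Measure.restrict_apply hT, Measure.map_apply hGm hT, withDensity_apply _ (hGm hT),
      Measure.restrict_restrict (hGm hT)]
    simp_rw [← det_fderiv_gradVec hw]
    refine le_trans (measure_mono ?_) (addHaar_image_le_lintegral_abs_det_fderiv volume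
      ((hGm hT).inter hΓ) fun x _ =>
        ((hG.differentiable (by simp)) x).hasFDerivAt.hasFDerivWithinAt)
    rintro p ⟨hpT, hp⟩
    obtain ⟨x, hx, rfl⟩ := ball_subset_image_gradVec hw hβ hx₀ hlt hp
    exact ⟨x, ⟨hpT, hx⟩, rfl⟩
  calc _ ≤ _ := lintegral_mono' hle le_rfl
    _ = _ := by
      rw [lintegral_map hh hGm, 
        lintegral_withDensity_eq_lintegral_mul _ hdet (g := fun x => h (gradVec w x)) (hh.comp hGm)]
      rfl

end Smooth

/-! ### The weighted Aleksandrov estimate in `W^2_d`. -/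

theorem ENNReal.sum_pow_le_card_pow_mul_sum_pow {ι : Type*} (s : Finset ι) (f : ι → ℝ≥0∞) {n : ℕ}
    (hn : n ≠ 0) : (∑ i ∈ s, f i) ^ n ≤ (s.card : ℝ≥0∞) ^ n * ∑ i ∈ s, f i ^ n := by
  rcases s.eq_empty_or_nonempty with rfl | hs
  · simp [hn]
  obtain ⟨k, hk, hmax⟩ := s.exists_max_image f hs
  have h1 : ∑ i ∈ s, f i ≤ s.card * f k := by
    simpa using Finset.sum_le_card_nsmul s f (f k) hmax
  calc _ ≤ ((s.card : ℝ≥0∞) * f k) ^ n := by gcongr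
    _ = (s.card : ℝ≥0∞) ^ n * f k ^ n := mul_pow _ _ _
    _ ≤ _ := by
      gcongr
      exact Finset.single_le_sum (f := fun i => f i ^ n) (fun _ _ => zero_le) hk

theorem ENNReal.add_pow_le_two_pow_mul (x y : ℝ≥0∞) (n : ℕ) :
    (x + y) ^ n ≤ 2 ^ n * (x ^ n + y ^ n) := by
  rcases le_total x y with h | h
  · calc (x + y) ^ n ≤ (2 * y) ^ n := by rw [two_mul]; gcongr
      _ ≤ _ := by rw [mul_pow]; gcongr; exact le_add_self
  · calc (x + y) ^ n ≤ (2 * x) ^ n := by rw [two_mul]; gcongr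
      _ ≤ _ := by rw [mul_pow]; gcongr; exact le_self_add

theorem MeasureTheory.MemLp.lintegral_enorm_pow_ne_top {α : Type*} [MeasurableSpace α]
    {μ : Measure α} {f : α → ℝ} {n : ℕ} (hn : n ≠ 0) (hf : MemLp f n μ) :
    ∫⁻ x, ‖f x‖ₑ ^ n ∂μ ≠ ⊤ := by
  have := lintegral_rpow_enorm_lt_top_of_eLpNorm_lt_top (by exact_mod_cast hn)
    (ENNReal.natCast_ne_top n) hf.eLpNorm_lt_top
  simpa using this.ne

theorem IsUniformlyElliptic.ofReal_sum_le {d : ℕ} {δ : ℝ}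
    {a : EuclideanSpace ℝ (Fin d) → Matrix (Fin d) (Fin d) ℝ} (hδ : 0 < δ)
    (ha : IsUniformlyElliptic δ a) (x : EuclideanSpace ℝ (Fin d)) (X : Fin d → Fin d → ℝ) :
    ENNReal.ofReal (∑ i, ∑ j, a x i j * X i j) ≤
      ENNReal.ofReal δ⁻¹ * ∑ p : Fin d × Fin d, ‖X p.1 p.2‖ₑ := by
  have h : ∑ i, ∑ j, a x i j * X i j ≤ δ⁻¹ * ∑ p : Fin d × Fin d, |X p.1 p.2| := by
    rw [Fintype.sum_prod_type (f := fun p : Fin d × Fin d => |X p.1 p.2|), Finset.mul_sum]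
    refine Finset.sum_le_sum fun i _ => ?_
    rw [Finset.mul_sum]
    refine Finset.sum_le_sum fun j _ => (le_abs_self _).trans ?_
    rw [abs_mul]
    gcongr
    exact ha.abs_apply_le hδ x i j
  refine (ENNReal.ofReal_le_ofReal h).trans_eq ?_
  rw [ENNReal.ofReal_mul (by positivity), ENNReal.ofReal_sum_of_nonneg fun _ _ => abs_nonneg _]
  simp only [Real.enorm_eq_ofReal_abs]

/-- The pointwise bound behind the Aleksandrov estimate. -/
theorem IsUniformlyElliptic.ofReal_abs_det_le {d : ℕ} {δ : ℝ}
    {a : EuclideanSpace ℝ (Fin d) → Matrix (Fin d) (Fin d) ℝ} (hδ : 0 < δ)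
    (ha : IsUniformlyElliptic δ a) (x : EuclideanSpace ℝ (Fin d)) {H : Matrix (Fin d) (Fin d) ℝ}
    (hH : H.PosSemidef) (X : Fin d → Fin d → ℝ) :
    ENNReal.ofReal |H.det| ≤ ENNReal.ofReal δ⁻¹ ^ d *
      (ENNReal.ofReal (∑ i, ∑ j, a x i j * X i j) +
        ENNReal.ofReal δ⁻¹ * ∑ p : Fin d × Fin d, ‖H p.1 p.2 - X p.1 p.2‖ₑ) ^ d := by
  have h1 : H.trace ≤ δ⁻¹ * ∑ i, ∑ j, a x i j * H i j := by
    rw [inv_mul_eq_div, le_div_iff₀ hδ, mul_comm]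
    exact ha.mul_trace_le x hH
  have h2 : ∑ i, ∑ j, a x i j * H i j =
      ∑ i, ∑ j, a x i j * X i j + ∑ i, ∑ j, a x i j * (H i j - X i j) := by
    simp only [← Finset.sum_add_distrib]
    exact Finset.sum_congr rfl fun i _ => Finset.sum_congr rfl fun j _ => by ring
  rw [abs_of_nonneg hH.det_nonneg, ← mul_pow]
  calc _ ≤ ENNReal.ofReal (H.trace ^ d) :=
        ENNReal.ofReal_le_ofReal (by simpa using hH.det_le_trace_pow)
    _ = ENNReal.ofReal H.trace ^ d := ENNReal.ofReal_pow hH.trace_nonneg d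
    _ ≤ _ := by
      gcongr
      refine (ENNReal.ofReal_le_ofReal h1).trans ?_
      rw [ENNReal.ofReal_mul (by positivity), h2]
      gcongr
      refine ENNReal.ofReal_add_le.trans ?_
      gcongr
      exact ha.ofReal_sum_le hδ x fun i j => H i j - X i j

section

variable {d : ℕ} {δ r s β : ℝ} {a : EuclideanSpace ℝ (Fin d) → Matrix (Fin d) (Fin d) ℝ}
  {w : ℕ → EuclideanSpace ℝ (Fin d) → ℝ} {v : EuclideanSpace ℝ (Fin d) → ℝ}
  {Dv : Fin d → EuclideanSpace ℝ (Fin d) → ℝ} {D2v : Fin d → Fin d → EuclideanSpace ℝ (Fin d) → ℝ}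

/-- The **Aleksandrov estimate** for functions with second derivatives in `L^d`. -/
theorem IsSmoothApprox.lintegral_ball_le (hd : d ≠ 0) (H : IsSmoothApprox r w v Dv D2v)
    (hδ : 0 < δ) (ha : IsUniformlyElliptic δ a)
    (hD2 : ∀ i j, MemLp (D2v i j) d (volume.restrict (ball 0 r)))
    (hβ : ∀ x ∈ sphere (0 : EuclideanSpace ℝ (Fin d)) r, β ≤ v x) {x₀ : EuclideanSpace ℝ (Fin d)}
    (hx₀ : x₀ ∈ ball (0 : EuclideanSpace ℝ (Fin d)) r) (hlt : v x₀ < β - 2 * r * s)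
    {h : EuclideanSpace ℝ (Fin d) → ℝ≥0∞} (hh : Continuous h) {C : ℝ≥0∞} (hC : C ≠ ⊤)
    (hhC : ∀ p, h p ≤ C) :
    ∫⁻ p in ball 0 s, h p ≤ ENNReal.ofReal δ⁻¹ ^ d * 2 ^ d *
      ∫⁻ x in ball 0 r, ENNReal.ofReal (∑ i, ∑ j, a x i j * D2v i j x) ^ d *
        h (WithLp.toLp 2 fun i => Dv i x) := by
  set μ := volume.restrict (ball (0 : EuclideanSpace ℝ (Fin d)) r)
  set F : EuclideanSpace ℝ (Fin d) → ℝ≥0∞ := fun x =>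
    ENNReal.ofReal (∑ i, ∑ j, a x i j * D2v i j x)
  set c : ℝ≥0∞ := ENNReal.ofReal δ⁻¹
  have hc : c ≠ ⊤ := ENNReal.ofReal_ne_top
  -- `E n` is the cost of replacing the Hessian of `w n` by `D2v`. It tends to zero in `L^d`, and
  -- stays negligible after multiplication by the weight because `h ≤ C`.
  let E : ℕ → EuclideanSpace ℝ (Fin d) → ℝ≥0∞ := fun n x =>
    c * ∑ p : Fin d × Fin d, ‖hessMatrix (w n) x p.1 p.2 - D2v p.1 p.2 x‖ₑ
  have hFm : AEMeasurable F μ := by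
    refine AEMeasurable.ennreal_ofReal (Finset.aemeasurable_fun_sum _ fun i _ =>
      Finset.aemeasurable_fun_sum _ fun j _ => ?_)
    exact (ha.measurable i j).aemeasurable.mul (hD2 i j).aestronglyMeasurable.aemeasurable
  have hEm : ∀ n (p : Fin d × Fin d), AEMeasurable
      (fun x => ‖hessMatrix (w n) x p.1 p.2 - D2v p.1 p.2 x‖ₑ ^ d) μ := fun n p =>
    ((((H.contDiff n).partialDeriv.partialDeriv).continuous.aestronglyMeasurable.sub
      (hD2 p.1 p.2).aestronglyMeasurable).enorm.pow_const _)
  have hFfin : ∫⁻ x, F x ^ d ∂μ ≠ ⊤ := by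
    refine ne_top_of_le_ne_top ?_ (lintegral_mono fun x =>
      pow_le_pow_left' (ha.ofReal_sum_le hδ x fun i j => D2v i j x) d)
    simp_rw [mul_pow]
    rw [lintegral_const_mul' _ _ (by finiteness)]
    refine ENNReal.mul_ne_top (by finiteness) (ne_top_of_le_ne_top ?_ (lintegral_mono fun x =>
      ENNReal.sum_pow_le_card_pow_mul_sum_pow _ _ hd))
    rw [lintegral_const_mul' _ _ (by finiteness), lintegral_finsetSum' _ fun p _ =>
      (hD2 p.1 p.2).aestronglyMeasurable.enorm.pow_const _]
    exact ENNReal.mul_ne_top (by finiteness) (ENNReal.sum_ne_top.2 fun p _ =>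
      (hD2 p.1 p.2).lintegral_enorm_pow_ne_top hd)
  have hE : Tendsto (fun n => ∫⁻ x, E n x ^ d ∂μ) atTop (𝓝 0) := by
    have h1 : Tendsto (fun n => c ^ d * ((Finset.univ : Finset (Fin d × Fin d)).card ^ d *
        ∑ p : Fin d × Fin d, ∫⁻ x, ‖hessMatrix (w n) x p.1 p.2 - D2v p.1 p.2 x‖ₑ ^ d ∂μ))
        atTop (𝓝 0) := by
      have h2 := tendsto_finsetSum (Finset.univ : Finset (Fin d × Fin d)) fun p _ =>
        H.tendsto_second p.1 p.2
      rw [Finset.sum_const_zero] at h2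
      have h3 := ENNReal.Tendsto.const_mul (a := c ^ d) (ENNReal.Tendsto.const_mul
        (a := (Finset.univ : Finset (Fin d × Fin d)).card ^ d) h2
        (Or.inr (by finiteness))) (Or.inr (by finiteness))
      rw [mul_zero, mul_zero] at h3
      exact h3
    refine tendsto_of_tendsto_of_tendsto_of_le_of_le tendsto_const_nhds h1 (fun n => zero_le)
      fun n => ?_
    simp only [E, mul_pow]
    rw [lintegral_const_mul' _ _ (by finiteness)]
    gcongr
    refine (lintegral_mono fun x => ENNReal.sum_pow_le_card_pow_mul_sum_pow _ _ hd).trans_eq ?_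
    rw [lintegral_const_mul' _ _ (by finiteness), lintegral_finsetSum' _ fun p _ => hEm n p]
  have hgradm : ∀ n, Measurable (fun x => h (gradVec (w n) x)) := fun n =>
    hh.measurable.comp (contDiff_gradVec (H.contDiff n)).continuous.measurable
  have hlim : Tendsto (fun n => ∫⁻ x, F x ^ d * h (gradVec (w n) x) ∂μ) atTop
      (𝓝 (∫⁻ x, F x ^ d * h (WithLp.toLp 2 fun i => Dv i x) ∂μ)) := by
    refine tendsto_lintegral_of_dominated_convergence' (fun x => F x ^ d * C)
      (fun n => (hFm.pow_const _).mul (hgradm n).aemeasurable)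
      (fun n => Eventually.of_forall fun x => mul_le_mul' le_rfl (hhC _)) ?_ ?_
    · rw [lintegral_mul_const' _ _ hC]
      exact ENNReal.mul_ne_top hFfin hC
    · filter_upwards [ae_all_iff.2 H.tendsto_first] with x hx
      refine ENNReal.Tendsto.const_mul ((hh.tendsto _).comp ?_) (Or.inr (by finiteness))
      exact ((PiLp.continuous_toLp 2 _).tendsto _).comp (tendsto_pi_nhds.2 hx)
  have hlim2 := ENNReal.Tendsto.const_mul (a := c ^ d * 2 ^ d)
    (hlim.add (ENNReal.Tendsto.const_mul (a := C) hE (Or.inr hC))) (Or.inr (by finiteness))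
  simp only [mul_zero, add_zero] at hlim2
  refine ge_of_tendsto hlim2 ?_
  -- A third of the gap is given up on the sphere and another third at `x₀`, which leaves the
  -- inequality for `w n` strict.
  have hgap : 0 < (β - 2 * r * s - v x₀) / 3 := by linarith
  filter_upwards [Metric.tendstoUniformlyOn_iff.1 H.tendstoUniformlyOn _ hgap] with n hn
  have key := lintegral_ball_le_of_contDiff (H.contDiff n) (r := r) (s := s)
    (β := β - (β - 2 * r * s - v x₀) / 3) (fun x hx => by
      have h1 := (abs_lt.1 (hn x (sphere_subset_closedBall hx))).2
      linarith [hβ x hx]) hx₀ (by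
      have h1 := (abs_lt.1 (hn x₀ (ball_subset_closedBall hx₀))).1
      linarith) hh.measurable
  calc _ ≤ _ := key
    _ ≤ ∫⁻ x in {x ∈ ball 0 r | ∀ ξ, 0 ≤ fderiv ℝ (fderiv ℝ (w n)) x ξ ξ},
        c ^ d * (F x + E n x) ^ d * h (gradVec (w n) x) := by
      refine lintegral_mono_ae ?_
      have hc2 : Continuous (fderiv ℝ (fderiv ℝ (w n))) :=
        ((H.contDiff n).fderiv_right (m := ∞) le_rfl).continuous_fderiv (by simp)
      have hΓ : MeasurableSet {x ∈ ball (0 : EuclideanSpace ℝ (Fin d)) r |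
          ∀ ξ, 0 ≤ fderiv ℝ (fderiv ℝ (w n)) x ξ ξ} := by
        refine measurableSet_ball.inter (IsClosed.measurableSet ?_)
        change IsClosed {x : EuclideanSpace ℝ (Fin d) |
          ∀ ξ, 0 ≤ fderiv ℝ (fderiv ℝ (w n)) x ξ ξ}
        rw [Set.ofPred_forall]
        exact isClosed_iInter fun ξ => isClosed_le continuous_const (by fun_prop)
      filter_upwards [ae_restrict_mem hΓ] with x hx
      gcongr
      exact ha.ofReal_abs_det_le hδ x (hessMatrix_posSemidef (H.contDiff n) hx.2)
        fun i j => D2v i j x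
    _ ≤ ∫⁻ x, c ^ d * (F x + E n x) ^ d * h (gradVec (w n) x) ∂μ :=
      lintegral_mono' (Measure.restrict_mono (fun x hx => hx.1) le_rfl) le_rfl
    _ ≤ ∫⁻ x, c ^ d * 2 ^ d * (F x ^ d * h (gradVec (w n) x) + C * E n x ^ d) ∂μ := by
      refine lintegral_mono fun x => ?_
      calc _ ≤ c ^ d * (2 ^ d * (F x ^ d + E n x ^ d)) * h (gradVec (w n) x) := by
            gcongr; exact ENNReal.add_pow_le_two_pow_mul _ _ _
        _ = c ^ d * 2 ^ d * (F x ^ d * h (gradVec (w n) x) + h (gradVec (w n) x) * E n x ^ d) := by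
            ring
        _ ≤ _ := by gcongr; exact hhC _
    _ = _ := by
      have hm : AEMeasurable (fun x => F x ^ d * h (gradVec (w n) x)) μ :=
        (hFm.pow_const _).mul (hgradm n).aemeasurable
      rw [lintegral_const_mul' _ _ (by finiteness), lintegral_add_left' hm,
        lintegral_const_mul' _ _ hC]

end

/-! ### The Aleksandrov-Bakelman-Pucci estimate with drift. -/

/-- In polar coordinates the radial density `y^(d-1) / (y^d + 1)` is at least `1 / (2y)` for `y >
1`, so the integral diverges logarithmically. -/
theorem lintegral_inv_enorm_pow_add_one {d : ℕ} (hd : d ≠ 0) :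
    ∫⁻ p : EuclideanSpace ℝ (Fin d), (‖p‖ₑ ^ d + 1)⁻¹ = ⊤ := by
  by_contra hne
  have : Nontrivial (EuclideanSpace ℝ (Fin d)) := by
    have : NeZero d := ⟨hd⟩
    infer_instance
  have hpt : ∀ p : EuclideanSpace ℝ (Fin d),
      ‖(‖p‖ ^ d + 1)⁻¹‖ₑ = (‖p‖ₑ ^ d + 1)⁻¹ := by
    intro p
    rw [Real.enorm_of_nonneg (by positivity), ENNReal.ofReal_inv_of_pos (by positivity),
      ENNReal.ofReal_add (by positivity) zero_le_one, ENNReal.ofReal_pow (norm_nonneg _),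
      ofReal_norm, ENNReal.ofReal_one]
  have hint : Integrable (fun p : EuclideanSpace ℝ (Fin d) => (‖p‖ ^ d + 1)⁻¹) volume := by
    refine ⟨(Continuous.inv₀ (by fun_prop) fun p => by positivity).aestronglyMeasurable, ?_⟩
    rw [HasFiniteIntegral]
    simp_rw [hpt]
    exact lt_top_iff_ne_top.2 hne
  rw [integrable_fun_norm_addHaar volume (f := fun y : ℝ => (y ^ d + 1)⁻¹)] at hint
  simp only [finrank_euclideanSpace, Fintype.card_fin, smul_eq_mul] at hint
  have h1 : IntegrableOn (fun y : ℝ => 2 * (y ^ (d - 1) * (y ^ d + 1)⁻¹)) (Set.Ioi 1) :=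
    (hint.mono_set (Set.Ioi_subset_Ioi zero_le_one)).const_mul 2
  refine not_integrableOn_Ioi_inv (a := 1) (h1.mono' (by fun_prop) ?_)
  filter_upwards [ae_restrict_mem measurableSet_Ioi] with y hy
  have hy1 : (1 : ℝ) < y := hy
  have hy0 : 0 < y := one_pos.trans hy1
  have hp : 1 ≤ y ^ d := one_le_pow₀ hy1.le
  have he : y ^ (d - 1) * y = y ^ d := pow_sub_one_mul hd y
  rw [Real.norm_of_nonneg (by positivity), ← mul_assoc, ← div_eq_mul_inv,
    le_div_iff₀ (by positivity), inv_mul_le_iff₀ hy0]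
  nlinarith

/-- The integral of `(|p|^d + g^d)⁻¹` over balls of radius proportional to `g` is arbitrarily
large, uniformly in `g`. -/
theorem exists_lt_lintegral_ball_inv {d : ℕ} (hd : d ≠ 0) {K : ℝ≥0∞} (hK : K ≠ ⊤) :
    ∃ M : ℝ, 0 < M ∧ ∀ g : ℝ, 0 < g → K <
      ∫⁻ p in ball (0 : EuclideanSpace ℝ (Fin d)) (M * g), (‖p‖ₑ ^ d + ENNReal.ofReal g ^ d)⁻¹ := by
  have hm : ∀ c : ℝ≥0∞, Measurable fun p : EuclideanSpace ℝ (Fin d) => (‖p‖ₑ ^ d + c)⁻¹ :=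
    fun c => by fun_prop
  have hlim : Tendsto (fun n : ℕ => ∫⁻ p in ball (0 : EuclideanSpace ℝ (Fin d)) n,
      (‖p‖ₑ ^ d + 1)⁻¹) atTop (𝓝 ⊤) := by
    rw [← lintegral_inv_enorm_pow_add_one hd]
    exact (aecover_ball tendsto_natCast_atTop_atTop).lintegral_tendsto_of_countably_generated
      (hm 1).aemeasurable
  obtain ⟨n, hn, hn1⟩ :=
    ((hlim.eventually_const_lt (lt_top_iff_ne_top.2 hK)).and (eventually_ge_atTop 1)).exists
  refine ⟨n, by exact_mod_cast hn1, fun g hg => hn.trans_eq ?_⟩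
  have hg0 : ENNReal.ofReal g ^ d ≠ 0 := by positivity
  have hgt : ENNReal.ofReal g ^ d ≠ ⊤ := by finiteness
  have hmap := Measure.map_addHaar_smul (volume : Measure (EuclideanSpace ℝ (Fin d))) hg.ne'
  -- Under `p = g q` the Jacobian `g^d` cancels the homogeneity of the integrand, which reduces
  -- every `g` to the case `g = 1`.
  have h1 : ∫⁻ p in ball (0 : EuclideanSpace ℝ (Fin d)) (n * g),
      (‖p‖ₑ ^ d + ENNReal.ofReal g ^ d)⁻¹ ∂(Measure.map (g • ·) volume) =
      ∫⁻ p in ball (0 : EuclideanSpace ℝ (Fin d)) n,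
        (ENNReal.ofReal g ^ d)⁻¹ * (‖p‖ₑ ^ d + 1)⁻¹ := by
    rw [setLIntegral_map measurableSet_ball (hm _) (measurable_const_smul g)]
    congr 1
    · congr 1
      ext p
      simp [norm_smul, abs_of_pos hg, mul_comm (n : ℝ) g, mul_lt_mul_iff_right₀ hg]
    · ext p
      rw [enorm_smul, Real.enorm_of_nonneg hg.le, mul_pow,
        ← ENNReal.mul_inv (Or.inl hg0) (Or.inl hgt), mul_add, mul_one]
  rw [hmap, Measure.restrict_smul, lintegral_smul_measure, lintegral_const_mul _ (hm 1),
    finrank_euclideanSpace, Fintype.card_fin, smul_eq_mul, abs_of_pos (by positivity),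
    ENNReal.ofReal_inv_of_pos (by positivity), ENNReal.ofReal_pow hg.le] at h1
  exact ((ENNReal.mul_right_inj (ENNReal.inv_ne_zero.2 hgt) (ENNReal.inv_ne_top.2 hg0)).1 h1).symm

/-- The **Aleksandrov-Bakelman-Pucci estimate** with drift in `L^d`. -/
theorem exists_aleksandrov_const {d : ℕ} (hd : d ≠ 0) {δ : ℝ} (hδ : 0 < δ) {K : ℝ≥0∞}
    (hK : K ≠ ⊤) :
    ∃ M : ℝ, 0 < M ∧ ∀ (r g β : ℝ) (a : EuclideanSpace ℝ (Fin d) → Matrix (Fin d) (Fin d) ℝ)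
      (b : EuclideanSpace ℝ (Fin d) → EuclideanSpace ℝ (Fin d))
      (f : EuclideanSpace ℝ (Fin d) → ℝ≥0∞)
      (w : ℕ → EuclideanSpace ℝ (Fin d) → ℝ) (v : EuclideanSpace ℝ (Fin d) → ℝ)
      (Dv : Fin d → EuclideanSpace ℝ (Fin d) → ℝ)
      (D2v : Fin d → Fin d → EuclideanSpace ℝ (Fin d) → ℝ),
      0 < g → IsSmoothApprox r w v Dv D2v → IsUniformlyElliptic δ a →
      (∀ i j, MemLp (D2v i j) d (volume.restrict (ball 0 r))) →
      AEStronglyMeasurable b (volume.restrict (ball 0 r)) →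
      ∫⁻ x in ball 0 r, ‖b x‖ₑ ^ d ≤ K → ∫⁻ x in ball 0 r, f x ^ d ≤ ENNReal.ofReal g ^ d →
      (∀ᵐ x ∂(volume.restrict (ball 0 r)),
        ENNReal.ofReal (∑ i, ∑ j, a x i j * D2v i j x) ≤
          ‖b x‖ₑ * ‖(WithLp.toLp 2 fun i => Dv i x : EuclideanSpace ℝ (Fin d))‖ₑ + f x) →
      (∀ x ∈ sphere (0 : EuclideanSpace ℝ (Fin d)) r, β ≤ v x) →
      ∀ x ∈ ball (0 : EuclideanSpace ℝ (Fin d)) r, β - 2 * r * (M * g) ≤ v x := by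
  obtain ⟨M, hM, HM⟩ := exists_lt_lintegral_ball_inv hd
    (K := ENNReal.ofReal δ⁻¹ ^ d * 2 ^ d * (2 ^ d * (K + 1))) (by finiteness)
  refine ⟨M, hM, fun r g β a b f w v Dv D2v hg H ha hD2 hbm hb hf hineq hβ x₀ hx₀ => ?_⟩
  by_contra! hlt
  set γ := ENNReal.ofReal g ^ d
  have hγ0 : γ ≠ 0 := by positivity
  have hγt : γ ≠ ⊤ := by finiteness
  refine (HM g hg).not_ge ?_
  -- The weight gives `|b|^d |p|^d h ≤ |b|^d` and `f^d h ≤ γ⁻¹ f^d`, with total integrals at most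
  -- `K` and `1`. This is the `K + 1` in the choice of `M`; too large a dip of `v` would contradict
  -- that choice.
  have hA := H.lintegral_ball_le hd hδ ha hD2 hβ hx₀ hlt
    (h := fun p => (‖p‖ₑ ^ d + γ)⁻¹) (C := γ⁻¹)
    ((((ENNReal.continuous_pow d).comp continuous_enorm).add continuous_const).inv) (ENNReal.inv_ne_top.2 hγ0)
    (fun p => ENNReal.inv_le_inv.2 le_add_self)
  refine hA.trans ?_
  gcongr
  calc _ ≤ ∫⁻ x in ball (0 : EuclideanSpace ℝ (Fin d)) r,
        2 ^ d * (‖b x‖ₑ ^ d + γ⁻¹ * f x ^ d) := by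
        refine lintegral_mono_ae ?_
        filter_upwards [hineq] with x hx
        set p : EuclideanSpace ℝ (Fin d) := WithLp.toLp 2 fun i => Dv i x
        calc _ ≤ (‖b x‖ₑ * ‖p‖ₑ + f x) ^ d * (‖p‖ₑ ^ d + γ)⁻¹ := by gcongr
          _ ≤ 2 ^ d * ((‖b x‖ₑ * ‖p‖ₑ) ^ d + f x ^ d) * (‖p‖ₑ ^ d + γ)⁻¹ := by
            gcongr; exact ENNReal.add_pow_le_two_pow_mul _ _ _
          _ = 2 ^ d * (‖b x‖ₑ ^ d * (‖p‖ₑ ^ d * (‖p‖ₑ ^ d + γ)⁻¹) +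
              (‖p‖ₑ ^ d + γ)⁻¹ * f x ^ d) := by ring
          _ ≤ 2 ^ d * (‖b x‖ₑ ^ d * 1 + γ⁻¹ * f x ^ d) := by
            gcongr
            · rw [← div_eq_mul_inv]
              exact ENNReal.div_le_of_le_mul (by rw [one_mul]; exact le_self_add)
            · exact le_add_self
          _ = _ := by rw [mul_one]
    _ = 2 ^ d * ((∫⁻ x in ball 0 r, ‖b x‖ₑ ^ d) + γ⁻¹ * ∫⁻ x in ball 0 r, f x ^ d) := by
        rw [lintegral_const_mul' _ _ (by finiteness), lintegral_add_left' (hbm.enorm.pow_const _),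
          lintegral_const_mul' _ _ (ENNReal.inv_ne_top.2 hγ0)]
    _ ≤ 2 ^ d * (K + γ⁻¹ * γ) := by gcongr
    _ = _ := by rw [ENNReal.inv_mul_cancel hγ0 hγt]

/-! ### Barriers and dyadic shells. -/

section

variable {d : ℕ}

theorem partialDeriv_sub {i : Fin d} {f g : EuclideanSpace ℝ (Fin d) → ℝ} (hf : ContDiff ℝ ∞ f)
    (hg : ContDiff ℝ ∞ g) (x : EuclideanSpace ℝ (Fin d)) :
    partialDeriv i (fun y => f y - g y) x = partialDeriv i f x - partialDeriv i g x := by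
  simp only [partialDeriv]
  rw [fderiv_fun_sub (hf.differentiable (by simp) x) (hg.differentiable (by simp) x)]
  rfl

theorem partialDeriv_const_mul_comp_smul {i : Fin d} {f : EuclideanSpace ℝ (Fin d) → ℝ}
    (hf : ContDiff ℝ ∞ f) (c t : ℝ) (x : EuclideanSpace ℝ (Fin d)) :
    partialDeriv i (fun y => c * f (t • y)) x = c * t * partialDeriv i f (t • x) := by
  have h1 : HasFDerivAt (fun y : EuclideanSpace ℝ (Fin d) => t • y)
      (t • ContinuousLinearMap.id ℝ (EuclideanSpace ℝ (Fin d))) x := (hasFDerivAt_id x).const_smul t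
  have h2 : HasFDerivAt (fun y => c * f (t • y)) _ x :=
    ((hf.differentiable (by simp) (t • x)).hasFDerivAt.comp x h1).const_mul c
  simp only [partialDeriv, h2.fderiv]
  simp [mul_assoc]

theorem IsSmoothApprox.sub_contDiff {r : ℝ} {w : ℕ → EuclideanSpace ℝ (Fin d) → ℝ}
    {v ψ : EuclideanSpace ℝ (Fin d) → ℝ} {Dv : Fin d → EuclideanSpace ℝ (Fin d) → ℝ}
    {D2v : Fin d → Fin d → EuclideanSpace ℝ (Fin d) → ℝ} (H : IsSmoothApprox r w v Dv D2v)
    (hψ : ContDiff ℝ ∞ ψ) :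
    IsSmoothApprox r (fun n x => w n x - ψ x) (fun x => v x - ψ x)
      (fun i x => Dv i x - partialDeriv i ψ x) (fun i j x => D2v i j x - hessMatrix ψ x i j) where
  contDiff n := (H.contDiff n).sub hψ
  tendstoUniformlyOn := by
    rw [Metric.tendstoUniformlyOn_iff]
    intro ε hε
    filter_upwards [Metric.tendstoUniformlyOn_iff.1 H.tendstoUniformlyOn ε hε] with n hn x hx
    simpa using hn x hx
  tendsto_first i := by
    filter_upwards [H.tendsto_first i] with x hx
    simp only [partialDeriv_sub (H.contDiff _) hψ]
    exact hx.sub_const _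
  tendsto_second i j := by
    refine (H.tendsto_second i j).congr fun n => ?_
    have e : partialDeriv j (fun x => w n x - ψ x) =
        fun x => partialDeriv j (w n) x - partialDeriv j ψ x :=
      funext fun x => partialDeriv_sub (H.contDiff n) hψ x
    simp only [e, partialDeriv_sub (H.contDiff n).partialDeriv hψ.partialDeriv, hessMatrix,
      Matrix.of_apply, sub_sub_sub_cancel_right]

/-- A smooth function that is constant in the ball of radius `ρ` and vanishes outside the ball of
radius `2ρ`, with derivatives of the natural size. -/
theorem exists_radial_cutoff (d : ℕ) :
    ∃ A : ℝ, 0 < A ∧ ∀ c ρ : ℝ, 0 < c → 0 < ρ → ∃ ψ : EuclideanSpace ℝ (Fin d) → ℝ,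
      ContDiff ℝ ∞ ψ ∧ (∀ x ∈ ball 0 ρ, ψ x = c * ρ ^ 2) ∧ (∀ x ∈ sphere 0 (2 * ρ), ψ x = 0) ∧
      (∀ x, ‖gradVec ψ x‖ ≤ c * A * ρ) ∧ (∀ x ∈ ball 0 ρ, gradVec ψ x = 0) ∧
      ∀ x i j, |hessMatrix ψ x i j| ≤ c * A := by
  let φ : ContDiffBump (0 : EuclideanSpace ℝ (Fin d)) := ⟨1, 2, one_pos, one_lt_two⟩
  let η : EuclideanSpace ℝ (Fin d) → ℝ := φ
  have hη : ContDiff ℝ ∞ η := φ.contDiff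
  have hcs : HasCompactSupport η := φ.hasCompactSupport
  have hcs1 : ∀ i, HasCompactSupport (partialDeriv i η) := fun i => hcs.fderiv_apply ℝ _
  obtain ⟨A₁, hA₁⟩ : ∃ A, ∀ x, ‖gradVec η x‖ ≤ A := by
    refine (contDiff_gradVec hη).continuous.bounded_above_of_compact_support
      (hcs.mono' fun x hx => ?_)
    by_contra hx'
    refine hx ?_
    ext i
    have : fderiv ℝ η x = 0 := by
      by_contra hne
      exact hx' (support_fderiv_subset ℝ hne)
    simp [gradVec, partialDeriv, this]
  have hA₂ : ∀ i j, ∃ A, ∀ x, ‖partialDeriv i (partialDeriv j η) x‖ ≤ A := fun i j =>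
    hη.partialDeriv.partialDeriv.continuous.bounded_above_of_compact_support
      ((hcs1 j).fderiv_apply ℝ _)
  choose A₂ hA₂ using hA₂
  have hA₂0 : ∀ i j, 0 ≤ A₂ i j := fun i j => (norm_nonneg _).trans (hA₂ i j 0)
  have hA₁0 : 0 ≤ A₁ := (norm_nonneg _).trans (hA₁ 0)
  -- The summand `1` makes `A` positive.
  set A : ℝ := A₁ + ∑ i, ∑ j, A₂ i j + 1
  have hS0 : 0 ≤ ∑ i, ∑ j, A₂ i j :=
    Finset.sum_nonneg fun i _ => Finset.sum_nonneg fun j _ => hA₂0 i j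
  refine ⟨A, by positivity, fun c ρ hc hρ => ?_⟩
  have hA1 : ∀ x, ‖gradVec η x‖ ≤ A := fun x => (hA₁ x).trans (by simp only [A]; linarith)
  have hA2 : ∀ i j x, |partialDeriv i (partialDeriv j η) x| ≤ A := by
    intro i j x
    have h1 : A₂ i j ≤ ∑ j, A₂ i j :=
      Finset.single_le_sum (f := A₂ i) (fun j _ => hA₂0 i j) (Finset.mem_univ j)
    have h2 : ∑ j, A₂ i j ≤ ∑ i, ∑ j, A₂ i j :=
      Finset.single_le_sum (f := fun i => ∑ j, A₂ i j)
        (fun i _ => Finset.sum_nonneg fun j _ => hA₂0 i j) (Finset.mem_univ i)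
    have h3 := hA₂ i j x
    rw [Real.norm_eq_abs] at h3
    simp only [A]
    linarith
  -- The factor `ρ ^ 2` makes the Hessian bound independent of `ρ`, at the price of a gradient of
  -- order `ρ`.
  let ψ : EuclideanSpace ℝ (Fin d) → ℝ := fun x => c * ρ ^ 2 * η (ρ⁻¹ • x)
  have hψ1 : ∀ i, partialDeriv i ψ = fun x => c * ρ * partialDeriv i η (ρ⁻¹ • x) := fun i =>
    funext fun x => by
      rw [partialDeriv_const_mul_comp_smul hη]
      congr 1
      field_simp
  have hψg : ∀ x, gradVec ψ x = (c * ρ) • gradVec η (ρ⁻¹ • x) := fun x => by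
    ext i
    simp [gradVec, hψ1]
  have hconst : ∀ x ∈ ball (0 : EuclideanSpace ℝ (Fin d)) ρ, ψ x = c * ρ ^ 2 := fun x hx => by
    have : η (ρ⁻¹ • x) = 1 := φ.one_of_mem_closedBall (by
      rw [mem_closedBall_zero_iff, norm_smul, Real.norm_of_nonneg (by positivity),
        inv_mul_le_iff₀ hρ, mul_one]
      exact (mem_ball_zero_iff.1 hx).le)
    simp only [ψ, this, mul_one]
  refine ⟨ψ, contDiff_const.mul (hη.comp (contDiff_const_smul ρ⁻¹)), hconst,
    fun x hx => ?_, fun x => ?_, fun x hx => ?_, fun x i j => ?_⟩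
  · have : η (ρ⁻¹ • x) = 0 := φ.zero_of_le_dist (by
      rw [mem_sphere_zero_iff_norm] at hx
      rw [dist_zero_right, norm_smul, hx, Real.norm_of_nonneg (by positivity)]
      exact le_of_eq (by change (2 : ℝ) = _; field_simp))
    simp only [ψ, this, mul_zero]
  · rw [hψg, norm_smul, Real.norm_of_nonneg (by positivity)]
    calc c * ρ * ‖gradVec η (ρ⁻¹ • x)‖ ≤ c * ρ * A := by gcongr; exact hA1 _
      _ = c * A * ρ := by ring
  · have hev : ψ =ᶠ[𝓝 x] fun _ => c * ρ ^ 2 := by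
      filter_upwards [isOpen_ball.mem_nhds hx] with y hy using hconst y hy
    ext i
    simp [gradVec, partialDeriv, hev.fderiv_eq]
  · simp only [hessMatrix, Matrix.of_apply, hψ1]
    rw [partialDeriv_const_mul_comp_smul hη.partialDeriv, mul_inv_cancel_right₀ hρ.ne', abs_mul,
      abs_of_pos hc]
    gcongr
    exact hA2 i j _

theorem sum_mul_le_norm_mul_norm (b : EuclideanSpace ℝ (Fin d)) (y : Fin d → ℝ) :
    |∑ i, b i * y i| ≤ ‖b‖ * ‖(WithLp.toLp 2 y : EuclideanSpace ℝ (Fin d))‖ := by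
  have h := abs_real_inner_le_norm b (WithLp.toLp 2 y)
  simp only [PiLp.inner_apply, RCLike.inner_apply, conj_trivial] at h
  simpa only [mul_comm (b _)] using h

/-- Pigeonhole over `N` disjoint dyadic shells. -/
theorem exists_shell_lintegral_le {f : EuclideanSpace ℝ (Fin d) → ℝ≥0∞} {N : ℕ} (hN : N ≠ 0)
    {c : ℝ≥0∞} (h : ∫⁻ x in ball 0 (2 ^ N), f x ≤ N * c) :
    ∃ k < N, ∫⁻ x in ball 0 (2 ^ (k + 1)) \ ball 0 (2 ^ k), f x ≤ c := by
  have hdisj : Set.PairwiseDisjoint (↑(Finset.range N)) fun k : ℕ =>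
      ball (0 : EuclideanSpace ℝ (Fin d)) (2 ^ (k + 1)) \ ball 0 (2 ^ k) := by
    have key : ∀ j k : ℕ, j < k →
        Disjoint (ball (0 : EuclideanSpace ℝ (Fin d)) (2 ^ (j + 1)) \ ball 0 (2 ^ j))
          (ball 0 (2 ^ (k + 1)) \ ball 0 (2 ^ k)) := fun j k hjk =>
      Set.disjoint_left.2 fun x hx hx' =>
        hx'.2 (ball_subset_ball (pow_le_pow_right₀ one_le_two hjk) hx.1)
    intro j _ k _ hjk
    rcases lt_or_gt_of_ne hjk with h' | h'
    exacts [key j k h', (key k j h').symm]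
  have hsum : ∑ k ∈ Finset.range N, ∫⁻ x in ball 0 (2 ^ (k + 1)) \ ball 0 (2 ^ k), f x ≤
      ∑ k ∈ Finset.range N, c := by
    rw [← lintegral_biUnion_finset hdisj fun k _ => measurableSet_ball.diff measurableSet_ball]
    refine (lintegral_mono_set ?_).trans (h.trans_eq (by simp))
    refine Set.iUnion₂_subset fun k hk => Set.sdiff_subset.trans (ball_subset_ball ?_)
    exact pow_le_pow_right₀ one_le_two (by simpa using hk)
  by_contra! hlt
  exact (ENNReal.sum_lt_sum_of_nonempty (by simpa using hN)
    fun k hk => hlt k (by simpa using hk)).not_ge hsum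

/-! ### The weak maximum principle. -/

section Supersolution

variable {δ R : ℝ} {a : EuclideanSpace ℝ (Fin d) → Matrix (Fin d) (Fin d) ℝ}
  {b : EuclideanSpace ℝ (Fin d) → EuclideanSpace ℝ (Fin d)} {u : EuclideanSpace ℝ (Fin d) → ℝ}
  {Du : Fin d → EuclideanSpace ℝ (Fin d) → ℝ} {D2u : Fin d → Fin d → EuclideanSpace ℝ (Fin d) → ℝ}

theorem sum_mul_le_of_ellipticOp_eq {x : EuclideanSpace ℝ (Fin d)}
    (hx : ellipticOp a b Du D2u x = -1) :
    ∑ i, ∑ j, a x i j * D2u i j x ≤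
      ‖b x‖ * ‖(WithLp.toLp 2 fun i => Du i x : EuclideanSpace ℝ (Fin d))‖ - 1 := by
  have h := neg_le_of_abs_le (sum_mul_le_norm_mul_norm (b x) fun i => Du i x)
  rw [ellipticOp] at hx
  linarith

/-- The weak maximum principle with drift in `L^d`. -/
theorem MemW2.nonneg_of_ellipticOp_eq (hd : d ≠ 0) (hδ : 0 < δ) (ha : IsUniformlyElliptic δ a)
    (hbm : AEStronglyMeasurable b (volume.restrict (ball 0 R)))
    (hb : ∫⁻ x in ball 0 R, ‖b x‖ₑ ^ d ≠ ⊤) (hu : MemW2 (ball 0 R) d u Du D2u)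
    (huc : ContinuousOn u (closedBall 0 R))
    (heq : ∀ᵐ x ∂(volume.restrict (ball 0 R)), ellipticOp a b Du D2u x = -1)
    (hbd : ∀ x ∈ sphere (0 : EuclideanSpace ℝ (Fin d)) R, 0 ≤ u x) :
    ∀ x ∈ ball (0 : EuclideanSpace ℝ (Fin d)) R, 0 ≤ u x := by
  intro x hx
  rw [mem_ball_zero_iff] at hx
  obtain ⟨M, hM, HM⟩ := exists_aleksandrov_const hd hδ hb
  refine le_of_forall_pos_le_add fun ε hε => ?_
  have huu := (isCompact_closedBall (0 : EuclideanSpace ℝ (Fin d)) R).uniformContinuousOn_of_continuous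
    huc
  obtain ⟨η, hη, Hη⟩ := Metric.uniformContinuousOn_iff.1 huu (ε / 2) (half_pos hε)
  -- Smooth approximations exist only on smaller balls. Radial projection to the sphere of radius
  -- `R` and uniform continuity transfer the boundary condition to radius `r` with loss `ε / 2`.
  obtain ⟨r, hr1, hrR⟩ : ∃ r, max ‖x‖ (R - η) < r ∧ r < R :=
    exists_between (max_lt hx (by linarith))
  have hxr : ‖x‖ < r := (le_max_left _ _).trans_lt hr1
  have hηr : R - η < r := (le_max_right _ _).trans_lt hr1
  have hr0 : 0 < r := (norm_nonneg x).trans_lt hxr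
  have hsph : ∀ y ∈ sphere (0 : EuclideanSpace ℝ (Fin d)) r, -(ε / 2) ≤ u y := by
    intro y hy
    rw [mem_sphere_zero_iff_norm] at hy
    have hy' : ‖(R / r) • y‖ = R := by
      rw [norm_smul, hy, Real.norm_of_nonneg (div_nonneg (hr0.trans hrR).le hr0.le),
        div_mul_cancel₀ _ hr0.ne']
    have hdist : dist y ((R / r) • y) < η := by
      have : y - (R / r) • y = (1 - R / r) • y := by rw [sub_smul, one_smul]
      rw [dist_eq_norm, this, norm_smul, hy, Real.norm_of_nonpos (by
        rw [sub_nonpos, le_div_iff₀ hr0]; linarith)]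
      have : -(1 - R / r) * r = R - r := by field_simp; ring
      linarith
    have h1 := Hη y (by simpa [hy] using hrR.le) ((R / r) • y) (by simp [hy']) hdist
    have h2 := hbd ((R / r) • y) (by simp [hy'])
    have h3 := (abs_lt.1 (Real.dist_eq _ _ ▸ h1)).1
    linarith
  have hsub : ball (0 : EuclideanSpace ℝ (Fin d)) r ⊆ ball 0 R := ball_subset_ball hrR.le
  have hmono : volume.restrict (ball (0 : EuclideanSpace ℝ (Fin d)) r) ≤
      volume.restrict (ball 0 R) := Measure.restrict_mono hsub le_rfl
  obtain ⟨w, hw⟩ := hu.exists_isSmoothApprox (Nat.one_le_iff_ne_zero.2 hd) hrR huc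
  -- With `f = 0` any positive `g` is admissible; this one makes the loss `2 r M g` equal to `ε /
  -- 2`.
  have key := HM r (ε / (4 * r * M)) (-(ε / 2)) a b 0 w u Du D2u (by positivity) hw ha
    (fun i j => (hu.memLp_second i j).mono_measure hmono) (hbm.mono_measure hmono)
    (lintegral_mono_set hsub) (by simp [hd]) ?_ hsph x (by simpa using hxr)
  · have : 2 * r * (M * (ε / (4 * r * M))) = ε / 2 := by field_simp; norm_num
    linarith
  · filter_upwards [ae_mono hmono heq] with y hy
    rw [Pi.zero_apply, add_zero, ← ofReal_norm, ← ofReal_norm, ← ENNReal.ofReal_mul (norm_nonneg _)]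
    exact ENNReal.ofReal_le_ofReal ((sum_mul_le_of_ellipticOp_eq hy).trans (by linarith))

end Supersolution

end

/-! ### The lower bound. -/

theorem lemma4p4 (d : ℕ) (hd : 2 ≤ d) (δ : ℝ) (hδ : 0 < δ) (hδ' : δ ≤ 1) :
    ∃ ν : ℝ, 0 < ν ∧ ∀ K : ℝ, 0 ≤ K → ∃ R₀ : ℝ, 2 < R₀ ∧
      ∀ (a : EuclideanSpace ℝ (Fin d) → Matrix (Fin d) (Fin d) ℝ)
        (b : EuclideanSpace ℝ (Fin d) → EuclideanSpace ℝ (Fin d))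
        (u : EuclideanSpace ℝ (Fin d) → ℝ)
        (Du : Fin d → EuclideanSpace ℝ (Fin d) → ℝ)
        (D2u : Fin d → Fin d → EuclideanSpace ℝ (Fin d) → ℝ),
        IsUniformlyElliptic δ a →
        AEStronglyMeasurable b (volume.restrict (ball 0 R₀)) →
        eLpNorm b (d : ℝ≥0∞) (volume.restrict (ball 0 R₀)) ≤ ENNReal.ofReal K →
        MemW2 (ball 0 R₀) (d : ℝ≥0∞) u Du D2u →
        -- `u` is the continuous representative, which gives the boundary values their meaning
        ContinuousOn u (closedBall 0 R₀) →
        (∀ᵐ x ∂(volume.restrict (ball 0 R₀)), ellipticOp a b Du D2u x = -1) →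
        (∀ x ∈ sphere (0 : EuclideanSpace ℝ (Fin d)) R₀, 0 ≤ u x) →
        ∀ x ∈ ball (0 : EuclideanSpace ℝ (Fin d)) 1, ν ≤ u x := by
  have hd0 : d ≠ 0 := by omega
  have hdpos : (0 : ℝ) < d := by exact_mod_cast Nat.pos_of_ne_zero hd0
  obtain ⟨A, hA, HA⟩ := exists_radial_cutoff d
  -- Chosen so that the `d²` terms of `a^{ij} D_{ij} ψ`, each at most `δ⁻¹ c A` in absolute value,
  -- sum to at most `1`.
  set c : ℝ := δ / (d ^ 2 * A) with hc_def
  have hc : 0 < c := by positivity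
  refine ⟨c / 2, by positivity, fun K _ => ?_⟩
  obtain ⟨M, hM, HM⟩ := exists_aleksandrov_const hd0 hδ (K := ENNReal.ofReal K ^ d) (by finiteness)
  -- Makes the loss `2 (2ρ) M (c A ρ ε)` equal to half the barrier height `c ρ²`.
  set ε : ℝ := 1 / (8 * M * A) with hε_def
  have hε : 0 < ε := by positivity
  obtain ⟨N, hN⟩ := exists_nat_gt (max (K ^ d / ε ^ d) 1)
  have hN1 : (1 : ℝ) < N := (le_max_right _ _).trans_lt hN
  have hN0 : N ≠ 0 := by
    rintro rfl
    norm_num at hN1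
  have hKN : ENNReal.ofReal K ^ d ≤ N * ENNReal.ofReal ε ^ d := by
    rw [← ENNReal.ofReal_natCast, ← ENNReal.ofReal_pow hε.le,
      ← ENNReal.ofReal_mul (Nat.cast_nonneg N), ← ENNReal.ofReal_pow ‹0 ≤ K›]
    refine ENNReal.ofReal_le_ofReal ?_
    rw [← div_le_iff₀ (by positivity)]
    exact ((le_max_left _ _).trans_lt hN).le
  -- The shells fill at most `B_{2^N}`; the extra factor `2` keeps `B_{2ρ}` strictly inside, as the
  -- smooth approximation requires.
  refine ⟨2 ^ (N + 1), ?_, fun a b u Du D2u ha hbm hb hu huc heq hbd x hx => ?_⟩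
  · calc (2 : ℝ) = 2 ^ 1 := by norm_num
      _ < 2 ^ (N + 1) := pow_lt_pow_right₀ one_lt_two (by omega)
  have hbK : ∫⁻ x in ball 0 (2 ^ (N + 1)), ‖b x‖ₑ ^ d ≤ ENNReal.ofReal K ^ d := by
    rw [eLpNorm_eq_lintegral_rpow_enorm_toReal (by exact_mod_cast hd0) (by simp)] at hb
    simp only [ENNReal.toReal_natCast, ENNReal.rpow_natCast, one_div] at hb
    calc _ = ((∫⁻ x in ball 0 (2 ^ (N + 1)), ‖b x‖ₑ ^ d) ^ ((d : ℝ)⁻¹)) ^ d := by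
          rw [← ENNReal.rpow_natCast, ← ENNReal.rpow_mul,
            inv_mul_cancel₀ (by exact_mod_cast hd0), ENNReal.rpow_one]
      _ ≤ _ := by gcongr
  have hnonneg := hu.nonneg_of_ellipticOp_eq hd0 hδ ha hbm
    (ne_top_of_le_ne_top (by finiteness) hbK) huc heq hbd
  obtain ⟨k, hkN, hk⟩ := exists_shell_lintegral_le hN0 (((lintegral_mono_set (ball_subset_ball
    (pow_le_pow_right₀ one_le_two (Nat.le_succ N)))).trans hbK).trans hKN)
  set ρ : ℝ := 2 ^ k with hρ_def
  have hρ1 : 1 ≤ ρ := one_le_pow₀ one_le_two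
  have hρ0 : 0 < ρ := by positivity
  have h2ρ : (2 : ℝ) ^ (k + 1) = 2 * ρ := by rw [pow_succ, mul_comm]
  have h2ρR : 2 * ρ < 2 ^ (N + 1) := by
    rw [← h2ρ]
    exact pow_lt_pow_right₀ one_lt_two (by omega)
  rw [h2ρ] at hk
  obtain ⟨ψ, hψ, hψc, hψ0, hψg, hψg0, hψh⟩ := HA c ρ hc hρ0
  obtain ⟨w, hw⟩ := hu.exists_isSmoothApprox (by omega) h2ρR huc
  have hsub : ball (0 : EuclideanSpace ℝ (Fin d)) (2 * ρ) ⊆ ball 0 (2 ^ (N + 1)) :=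
    ball_subset_ball h2ρR.le
  have hmono : volume.restrict (ball (0 : EuclideanSpace ℝ (Fin d)) (2 * ρ)) ≤
      volume.restrict (ball 0 (2 ^ (N + 1))) := Measure.restrict_mono hsub le_rfl
  set S := ball (0 : EuclideanSpace ℝ (Fin d)) (2 * ρ) \ ball 0 ρ with hS_def
  have hS : MeasurableSet S := measurableSet_ball.diff measurableSet_ball
  -- The estimate for `u - ψ`, whose boundary values on radius `2ρ` are nonnegative. The source is
  -- cut off to `S` because `Dψ` vanishes in `B_ρ`, so only the small shell mass of `b` enters.
  have key := HM (2 * ρ) (c * A * ρ * ε) 0 a b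
    (S.indicator fun x => ENNReal.ofReal (c * A * ρ) * ‖b x‖ₑ) _ _ _ _ (by positivity)
    (hw.sub_contDiff hψ) ha (fun i j => ?_) (hbm.mono_measure hmono)
    ((lintegral_mono_set hsub).trans hbK) ?_ ?_ ?_ x
    (ball_subset_ball (by linarith) hx)
  · rw [hψc x (ball_subset_ball hρ1 hx)] at key
    have e : 2 * (2 * ρ) * (M * (c * A * ρ * ε)) = c * ρ ^ 2 / 2 := by
      rw [hε_def]
      field_simp
      norm_num
    have h1 : c * 1 ≤ c * ρ ^ 2 := by gcongr; exact one_le_pow₀ hρ1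
    linarith
  · have : IsFiniteMeasure (volume.restrict (ball (0 : EuclideanSpace ℝ (Fin d)) (2 * ρ))) :=
      isFiniteMeasure_restrict.2 measure_ball_lt_top.ne
    refine ((hu.memLp_second i j).mono_measure hmono).sub ?_
    refine MemLp.of_bound hψ.partialDeriv.partialDeriv.continuous.aestronglyMeasurable (c * A)
      (Eventually.of_forall fun x => hψh x i j)
  · have e : (fun x => S.indicator (fun x => ENNReal.ofReal (c * A * ρ) * ‖b x‖ₑ) x ^ d) =
        S.indicator fun x => ENNReal.ofReal (c * A * ρ) ^ d * ‖b x‖ₑ ^ d := by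
      ext x
      by_cases hxS : x ∈ S <;> simp [hxS, hd0, mul_pow]
    rw [e, setLIntegral_indicator hS, Set.inter_eq_self_of_subset_left Set.sdiff_subset,
      lintegral_const_mul' _ _ (by finiteness), ENNReal.ofReal_mul (p := c * A * ρ) (by positivity), mul_pow]
    exact mul_le_mul' le_rfl hk
  · filter_upwards [ae_mono hmono heq, ae_restrict_mem measurableSet_ball] with y hy hyb
    set p : EuclideanSpace ℝ (Fin d) := WithLp.toLp 2 fun i => Du i y
    set q : EuclideanSpace ℝ (Fin d) := WithLp.toLp 2 fun i => Du i y - partialDeriv i ψ y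
    have hpq : p = q + gradVec ψ y := by
      ext i
      simp [p, q, gradVec]
    have h1 := sum_mul_le_of_ellipticOp_eq hy
    have h2 : -∑ i, ∑ j, a y i j * hessMatrix ψ y i j ≤ 1 := by
      calc _ = ∑ i, ∑ j, -(a y i j * hessMatrix ψ y i j) := by simp only [Finset.sum_neg_distrib]
        _ ≤ ∑ i : Fin d, ∑ j : Fin d, δ⁻¹ * (c * A) := by
          refine Finset.sum_le_sum fun i _ => Finset.sum_le_sum fun j _ =>
            (neg_le_abs _).trans ?_
          rw [abs_mul]
          exact mul_le_mul (ha.abs_apply_le hδ y i j) (hψh y i j) (abs_nonneg _) (by positivity)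
        _ = 1 := by
          simp only [Finset.sum_const, Finset.card_univ, Fintype.card_fin, nsmul_eq_mul, hc_def]
          field_simp
    have h3 : ∑ i, ∑ j, a y i j * (D2u i j y - hessMatrix ψ y i j) ≤ ‖b y‖ * ‖p‖ := by
      simp only [mul_sub, Finset.sum_sub_distrib]
      linarith
    have h4 : ‖b y‖ₑ * ‖gradVec ψ y‖ₑ ≤
        S.indicator (fun x => ENNReal.ofReal (c * A * ρ) * ‖b x‖ₑ) y := by
      by_cases hyρ : y ∈ ball (0 : EuclideanSpace ℝ (Fin d)) ρ
      · simp [hψg0 y hyρ]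
      · rw [Set.indicator_of_mem (show y ∈ S from ⟨hyb, hyρ⟩), mul_comm, ← ofReal_norm (gradVec ψ y)]
        gcongr
        exact hψg y
    calc _ ≤ ENNReal.ofReal (‖b y‖ * ‖p‖) := ENNReal.ofReal_le_ofReal h3
      _ = ‖b y‖ₑ * ‖p‖ₑ := by
        rw [ENNReal.ofReal_mul (norm_nonneg _), ofReal_norm, ofReal_norm]
      _ ≤ ‖b y‖ₑ * (‖q‖ₑ + ‖gradVec ψ y‖ₑ) := by
        rw [hpq]
        gcongr
        exact enorm_add_le _ _
      _ = ‖b y‖ₑ * ‖q‖ₑ + ‖b y‖ₑ * ‖gradVec ψ y‖ₑ := mul_add _ _ _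
      _ ≤ _ := by gcongr
  · intro y hy
    rw [hψ0 y hy, sub_zero]
    refine hnonneg y ?_
    rw [mem_sphere_zero_iff_norm] at hy
    rw [mem_ball_zero_iff, hy]
    exact h2ρR
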